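/- Let $S$ be the set of finitely supported sequences $r=(r_1,r_2,\dots)$ of non-negative integers, write $|r|=\sum_i r_i$, and let $\mathbb C[[X_1,X_2,\dots]]$ be the algebra of all formal power series $\sum_{r\in S}\alpha_r X^r$ in countably many commuting indeterminates. Let $$\mathcal U=\Big\{\sum_{r\in S}\alpha_rX^r\;:\;q_m\Big(\sum_r\alpha_rX^r\Big):=\sum_{r\in S}|\alpha_r|\,m^{|r|}<\infty\ \text{ for all } m=1,2,3,\dots\Big\},$$ a subalgebra of $\mathbb C[[X_1,X_2,\dots]]$, and let $\tau_0$ be the topology on $\mathcal U$ defined by the norms $q_m$, $m\ge 1$. Let $\tau_c$ be the topology of coordinatewise convergence on $\mathbb C[[X_1,X_2]]$. Then $(\mathcal U,\tau_0)$ is a Fréchet algebra (it is complete and metrizable, and its topology is defined by an increasing sequence of submultiplicative seminorms) whose topology is not defined by a single seminorm (so it is not a Banach algebra). Moreover, algebraically $\mathbb C[X_1,X_2]\subset\mathcal U\subset\mathbb C[[X_1,X_2]]$ by an embedding that is not continuous: there is an injective unital algebra homomorphism $\Psi:\mathcal U\to\mathbb C[[X_1,X_2]]$ with $\Psi(X_1)=X_1$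 and $\Psi(X_2)=X_2$, whose range therefore contains all polynomials in $X_1,X_2$, such that $\Psi:(\mathcal U,\tau_0)\to(\mathbb C[[X_1,X_2]],\tau_c)$ is not continuous. -/

import Mathlib

noncomputable section

/-- The algebra `𝒰` as a subalgebra of the algebra `ℂ[[X₀, X₁, X₂, …]]` of formal power series in
countably many commuting indeterminates: `𝒰 = ⋂ₘ ℓ¹(S, ωₘ)`, where `S` is the additive monoid of
finitely supported sequences of natural numbers and `ωₘ(r) = m ^ |r|` for `m = 1, 2, 3, …`
(the index `m : ℕ` below stands for the weight `ω_{m+1}`). -/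
def testSubalgebra : Subalgebra ℂ (MvPowerSeries ℕ ℂ) where
  carrier := {f | ∀ m : ℕ, Summable fun r : ℕ →₀ ℕ =>
    ‖MvPowerSeries.coeff r f‖ * ((m : ℝ) + 1) ^ r.degree}
  add_mem' := by
    intro f g hf hg m
    refine Summable.of_nonneg_of_le (fun r => by positivity) (fun r => ?_) ((hf m).add (hg m))
    rw [← add_mul, map_add]
    exact mul_le_mul_of_nonneg_right (norm_add_le _ _) (by positivity)
  mul_mem' := by
    intro f g hf hg m
    have h0 : ∀ (k : MvPowerSeries ℕ ℂ) (r : ℕ →₀ ℕ),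
        0 ≤ ‖MvPowerSeries.coeff r k‖ * ((m : ℝ) + 1) ^ r.degree := fun k r => by positivity
    have h1 := (hf m).mul_of_nonneg (hg m) (h0 f) (h0 g)
    have h := summable_sum_mul_antidiagonal_of_summable_mul
      (f := fun r : ℕ →₀ ℕ => ‖MvPowerSeries.coeff r f‖ * ((m : ℝ) + 1) ^ r.degree)
      (g := fun r : ℕ →₀ ℕ => ‖MvPowerSeries.coeff r g‖ * ((m : ℝ) + 1) ^ r.degree) h1
    refine Summable.of_nonneg_of_le (fun r => by positivity) (fun r => ?_) h
    rw [MvPowerSeries.coeff_mul]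
    refine (mul_le_mul_of_nonneg_right (norm_sum_le _ _) (by positivity)).trans ?_
    rw [Finset.sum_mul]
    refine Finset.sum_le_sum fun p hp => le_of_eq ?_
    rw [← Finset.HasAntidiagonal.mem_antidiagonal.mp hp, map_add, norm_mul, pow_add]
    ring
  algebraMap_mem' := by
    intro c m
    refine summable_of_ne_finset_zero (s := {0}) fun r hr => ?_
    have hr' : r ≠ 0 := by simpa using hr
    rw [MvPowerSeries.algebraMap_apply, MvPowerSeries.coeff_C, if_neg hr', norm_zero, zero_mul]

/-- The algebra `𝒰` as a type of its own (so that it carries only the topology given below). -/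
def TestAlgebra : Type := testSubalgebra

namespace TestAlgebra

instance : CommRing TestAlgebra := inferInstanceAs (CommRing testSubalgebra)

instance : Algebra ℂ TestAlgebra := inferInstanceAs (Algebra ℂ testSubalgebra)

/-- The inclusion of `𝒰` in `ℂ[[X₀, X₁, X₂, …]]`. -/
def val : TestAlgebra →ₐ[ℂ] MvPowerSeries ℕ ℂ := testSubalgebra.val

/-- The indeterminate `Xᵢ`, as an element of `𝒰`. -/
def X (i : ℕ) : TestAlgebra :=
  ⟨MvPowerSeries.X i, by
    intro m
    refine summable_of_ne_finset_zero (s := {Finsupp.single i 1}) fun r hr => ?_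
    have hr' : r ≠ Finsupp.single i 1 := by simpa using hr
    rw [MvPowerSeries.coeff_X, if_neg hr', norm_zero, zero_mul]⟩

theorem summable_coeff (f : TestAlgebra) (m : ℕ) : Summable fun r : ℕ →₀ ℕ =>
    ‖MvPowerSeries.coeff r (val f)‖ * ((m : ℝ) + 1) ^ r.degree :=
  f.2 m

/-- The weighted `ℓ¹`-norms `∑ᵣ |αᵣ| (m + 1) ^ |r|` of `∑ᵣ αᵣ Xʳ`, for `m = 0, 1, 2, …`. -/
def q : SeminormFamily ℂ TestAlgebra ℕ := fun m =>
  Seminorm.ofSMulLE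
    (fun f => ∑' r : ℕ →₀ ℕ,
      ‖MvPowerSeries.coeff r (val f)‖ * ((m : ℝ) + 1) ^ r.degree)
    (by simp)
    (fun f g => by
      rw [← (summable_coeff f m).tsum_add (summable_coeff g m)]
      refine (summable_coeff (f + g) m).tsum_le_tsum (fun r => ?_)
        ((summable_coeff f m).add (summable_coeff g m))
      rw [← add_mul, map_add, map_add]
      exact mul_le_mul_of_nonneg_right (norm_add_le _ _) (by positivity))
    (fun c f => le_of_eq (by simp [mul_assoc, tsum_mul_left]))

/-- The topology `τ₀` of `𝒰` (with the uniform structure that induces it): the one generated by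
the norms `q m`. -/
instance : UniformSpace TestAlgebra :=
  ⨅ m : ℕ, (q m).toSeminormedAddCommGroup.toUniformSpace

instance : IsUniformAddGroup TestAlgebra :=
  isUniformAddGroup_iInf fun m => by
    let _ := (q m).toSeminormedAddCommGroup
    infer_instance

end TestAlgebra

/-- A (unital, complex) Fréchet algebra: a complete metrizable algebra whose topology is defined by
an increasing sequence of submultiplicative seminorms. -/
structure IsFrechetAlgebra (A : Type*) [Ring A] [Algebra ℂ A] [UniformSpace A]
    [IsUniformAddGroup A] : Prop where
  complete : CompleteSpace A
  metrizable : TopologicalSpace.MetrizableSpace A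
  exists_seminorms : ∃ p : SeminormFamily ℂ A ℕ, Monotone p ∧
    (∀ m x y, p m (x * y) ≤ p m x * p m y) ∧ WithSeminorms p

/-- The topology is defined by a single norm or seminorm. -/
def IsNormable (A : Type*) [AddCommGroup A] [Module ℂ A] [TopologicalSpace A] : Prop :=
  ∃ p : Seminorm ℂ A, WithSeminorms fun _ : Unit => p

/-- The topology `τ_c` of coordinatewise convergence on `ℂ[[X₁, X₂]]`. -/
abbrev coordinateTopology : TopologicalSpace (MvPowerSeries (Fin 2) ℂ) :=
  MvPowerSeries.WithPiTopology.instTopologicalSpace ℂ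

end

open Filter Topology

/-! ### The Fréchet algebra `𝒰` and its non-normability -/

namespace TestAlgebra

/-! The Fréchet part is the usual theory of weighted `ℓ¹` convolution algebras. The embedding `Ψ` is
an injective substitution `Φ` twisted by the exponential of a discontinuous derivation `D`.

`Φ` sends `X₀ ↦ x₁`, `X₁ ↦ x₂` and `Xᵢ ↦ x₁ φᵢ(x₂)` for `i ≥ 2`, with lacunary `φᵢ` whose
coefficients grow very fast. Give `X₁` weight `0` and the other indeterminates weight `1`: then `Φ`
carries weight to degree in `x₁`. If a homogeneous `f ∈ 𝒰` had `Φ f = 0` but `Φ (∂ᵢ f) ≠ 0` for some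
`i ≥ 2`, the new term at a late stage `s` would contribute `c_s` times a fixed nonzero number, while
everything older is bounded by a constant times a fixed power of `S_s`
(`growth_le_of_subst_eq_zero`). Induction on the weight gives injectivity
(`eq_zero_of_subst_imageSeries_eq_zero`).

`D` kills every `Xᵢ`, but `D u` has nonzero constant term for the infinite-rank quadratic form `u =
diagForm`; it lowers weight by at most `2` (`exists_wild_derivation`). Put `Ψ f = ∑ⱼ x₁ ^ (3 j) Φ(Dʲ
f) / j!`. This is multiplicative by the Leibniz rule. As `3 > 2`, the terms with `j ≥ 1` do not
reach the lowest weight of `f`, so `Ψ` inherits injectivity (`eq_zero_of_twist_eq_zero`). The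
partial sums of `u` are polynomials, on which `Ψ = Φ` has no `x₁ ^ 3` coefficient, whereas `Ψ u` has
one: continuity fails. -/

theorem q_apply (m : ℕ) (f : TestAlgebra) :
    q m f = ∑' r : ℕ →₀ ℕ, ‖MvPowerSeries.coeff r (val f)‖ * ((m : ℝ) + 1) ^ r.degree := rfl

theorem val_injective : Function.Injective val := Subtype.val_injective

theorem norm_coeff_le_q (m : ℕ) (f : TestAlgebra) (r : ℕ →₀ ℕ) :
    ‖MvPowerSeries.coeff r (val f)‖ ≤ q m f := by
  have h1 := (summable_coeff f m).le_tsum r (fun s _ => by positivity)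
  have h2 : (1 : ℝ) ≤ ((m : ℝ) + 1) ^ r.degree := one_le_pow₀ (by simp)
  exact (le_mul_of_one_le_right (norm_nonneg _) h2).trans h1

theorem q_monotone : Monotone q := by
  intro m n hmn f
  refine (summable_coeff f m).tsum_le_tsum (fun r => ?_) (summable_coeff f n)
  have : (m : ℝ) ≤ n := by exact_mod_cast hmn
  gcongr

theorem summable_antidiagonal {f g : (ℕ →₀ ℕ) → ℝ} (hf : Summable f) (hg : Summable g)
    (hf0 : ∀ r, 0 ≤ f r) (hg0 : ∀ r, 0 ≤ g r) :
    Summable (fun r => ∑ p ∈ Finset.HasAntidiagonal.antidiagonal r, f p.1 * g p.2) ∧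
      ∑' r, ∑ p ∈ Finset.HasAntidiagonal.antidiagonal r, f p.1 * g p.2 = (∑' r, f r) * ∑' r, g r := by
  have h := hf.mul_of_nonneg hg hf0 hg0
  exact ⟨summable_sum_mul_antidiagonal_of_summable_mul h,
    (hf.tsum_mul_tsum_eq_tsum_sum_antidiagonal hg h).symm⟩

theorem q_mul_le (m : ℕ) (f g : TestAlgebra) : q m (f * g) ≤ q m f * q m g := by
  obtain ⟨h1, h2⟩ := summable_antidiagonal (summable_coeff f m) (summable_coeff g m)
    (fun r => by positivity) (fun r => by positivity)
  rw [q_apply m f, q_apply m g, ← h2]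
  refine (summable_coeff (f * g) m).tsum_le_tsum (fun r => ?_) h1
  rw [map_mul, MvPowerSeries.coeff_mul]
  refine (mul_le_mul_of_nonneg_right (norm_sum_le _ _) (by positivity)).trans ?_
  rw [Finset.sum_mul]
  refine Finset.sum_le_sum fun p hp => le_of_eq ?_
  rw [← Finset.HasAntidiagonal.mem_antidiagonal.mp hp, map_add, norm_mul, pow_add]
  ring

theorem withSeminorms_q : WithSeminorms q :=
  q.withSeminorms_iff_uniformSpace_eq_iInf.mpr rfl

theorem eq_zero_of_q_eq_zero {f : TestAlgebra} {m : ℕ} (h : q m f = 0) : f = 0 := by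
  refine val_injective (MvPowerSeries.ext fun r => ?_)
  have := norm_coeff_le_q m f r
  rw [h] at this
  simpa using this

instance : T1Space TestAlgebra :=
  withSeminorms_q.T1_of_separating fun _ hx => ⟨0, fun h => hx (eq_zero_of_q_eq_zero h)⟩

instance : FirstCountableTopology TestAlgebra := withSeminorms_q.firstCountableTopology

instance : (uniformity TestAlgebra).IsCountablyGenerated :=
  IsUniformAddGroup.uniformity_countably_generated

theorem exists_q_sub_lt {u : ℕ → TestAlgebra} (hu : CauchySeq u) (m : ℕ) {ε : ℝ} (hε : 0 < ε) :
    ∃ N, ∀ n ≥ N, ∀ k ≥ N, q m (u n - u k) < ε := by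
  have h1 : ∀ᶠ x in 𝓝 (0 : TestAlgebra), q m x < ε := by
    have := (withSeminorms_q.continuous_seminorm m).tendsto 0
    rw [map_zero] at this
    exact this.eventually (gt_mem_nhds hε)
  rw [cauchySeq_iff] at hu
  obtain ⟨N, hN⟩ := hu {p | q m (p.1 - p.2) < ε} (by
    rw [uniformity_eq_comap_nhds_zero_swapped]
    exact ⟨_, h1, fun p hp => hp⟩)
  exact ⟨N, fun n hn k hk => hN n hn k hk⟩

theorem exists_coeff_limit {u : ℕ → TestAlgebra} (hu : CauchySeq u) (r : ℕ →₀ ℕ) :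
    ∃ a : ℂ, Tendsto (fun n => MvPowerSeries.coeff r (val (u n))) atTop (𝓝 a) := by
  refine cauchySeq_tendsto_of_complete (Metric.cauchySeq_iff.mpr fun ε hε => ?_)
  obtain ⟨N, hN⟩ := exists_q_sub_lt hu 0 hε
  refine ⟨N, fun n hn k hk => ?_⟩
  rw [dist_eq_norm, ← map_sub, ← map_sub]
  exact (norm_coeff_le_q 0 _ r).trans_lt (hN n hn k hk)

/-- The limit is taken coefficientwise. Finite partial sums of the norms pass to the limit with the
Cauchy bound, which gives both membership in `𝒰` and convergence in every `q m`. -/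
instance : CompleteSpace TestAlgebra := by
  refine UniformSpace.complete_of_cauchySeq_tendsto fun u hu => ?_
  choose a ha using exists_coeff_limit hu
  let f : MvPowerSeries ℕ ℂ := a
  have hf : ∀ r, MvPowerSeries.coeff r f = a r := fun r => rfl
  have key : ∀ (m : ℕ) (ε : ℝ), 0 < ε → ∃ N, ∀ n ≥ N, ∀ F : Finset (ℕ →₀ ℕ),
      ∑ r ∈ F, ‖MvPowerSeries.coeff r (val (u n) - f)‖ * ((m : ℝ) + 1) ^ r.degree ≤ ε := by
    intro m ε hε
    obtain ⟨N, hN⟩ := exists_q_sub_lt hu m hε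
    refine ⟨N, fun n hn F => ?_⟩
    have h1 : Tendsto (fun k => ∑ r ∈ F, ‖MvPowerSeries.coeff r (val (u n - u k))‖ *
        ((m : ℝ) + 1) ^ r.degree) atTop
        (𝓝 (∑ r ∈ F, ‖MvPowerSeries.coeff r (val (u n) - f)‖ * ((m : ℝ) + 1) ^ r.degree)) := by
      refine tendsto_finsetSum _ fun r _ => (Tendsto.norm ?_).mul_const _
      simp only [map_sub, hf]
      exact (ha r).const_sub _
    refine le_of_tendsto h1 (eventually_atTop.mpr ⟨N, fun k hk => ?_⟩)
    exact ((summable_coeff _ m).sum_le_tsum F (fun r _ => by positivity)).trans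
      (hN n hn k hk).le
  have key' : ∀ (m : ℕ) (ε : ℝ), 0 < ε → ∃ N, ∀ n ≥ N, Summable fun r : ℕ →₀ ℕ =>
      ‖MvPowerSeries.coeff r (val (u n) - f)‖ * ((m : ℝ) + 1) ^ r.degree := by
    intro m ε hε
    obtain ⟨N, hN⟩ := key m ε hε
    exact ⟨N, fun n hn => summable_of_sum_le (fun r => by positivity) (hN n hn)⟩
  have hmem : f ∈ testSubalgebra := by
    intro m
    obtain ⟨N, hN⟩ := key' m 1 one_pos
    refine Summable.of_nonneg_of_le (fun r => by positivity) (fun r => ?_)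
      ((summable_coeff (u N) m).add (hN N le_rfl))
    rw [← add_mul]
    refine mul_le_mul_of_nonneg_right ?_ (by positivity)
    rw [map_sub, add_comm, norm_sub_rev]
    exact norm_le_norm_sub_add _ _
  obtain ⟨g, hg⟩ : ∃ g : TestAlgebra, val g = f := ⟨⟨f, hmem⟩, rfl⟩
  refine ⟨g, ?_⟩
  rw [withSeminorms_q.tendsto_nhds]
  intro m ε hε
  obtain ⟨N, hN⟩ := key m (ε / 2) (by positivity)
  refine eventually_atTop.mpr ⟨N, fun n hn => ?_⟩
  have h1 : q m (u n - g) ≤ ε / 2 := by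
    refine (summable_coeff (u n - g) m).tsum_le_of_sum_le fun F => ?_
    rw [map_sub, hg]
    exact hN n hn F
  linarith

theorem isFrechetAlgebra : IsFrechetAlgebra TestAlgebra where
  complete := inferInstance
  metrizable := UniformSpace.metrizableSpace
  exists_seminorms := ⟨q, q_monotone, q_mul_le, withSeminorms_q⟩

theorem val_X (i : ℕ) : val (X i) = MvPowerSeries.X i := rfl

theorem q_X_pow (m i n : ℕ) : q m (X i ^ n) = ((m : ℝ) + 1) ^ n := by
  classical
  rw [q_apply, tsum_eq_single (Finsupp.single i n)]
  · simp [val_X, MvPowerSeries.coeff_X_pow]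
  · intro r hr
    simp [val_X, MvPowerSeries.coeff_X_pow, hr]

/-- A single defining seminorm would force `q (M + 1) ≤ K q M` for some `M` and `K`; the powers of
one indeterminate violate this, their norms having ratio `((M + 2) / (M + 1)) ^ n`. -/
theorem not_isNormable : ¬ IsNormable TestAlgebra := by
  rintro ⟨p, hp⟩
  have h1 : Continuous p := hp.continuous_seminorm ()
  obtain ⟨s, C, -, hC⟩ := Seminorm.bound_of_continuous withSeminorms_q p h1
  obtain ⟨M, hM⟩ : ∃ M, s.sup q ≤ q M :=
    ⟨s.sup id, Finset.sup_le fun i hi => q_monotone (Finset.le_sup (f := id) hi)⟩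
  obtain ⟨t, B, -, hB⟩ := Seminorm.bound_of_continuous hp _
    (withSeminorms_q.continuous_seminorm (M + 1))
  have hB' : ∀ x, q (M + 1) x ≤ B * p x := by
    intro x
    refine (hB x).trans ?_
    rw [smul_apply, NNReal.smul_def, smul_eq_mul]
    refine mul_le_mul_of_nonneg_left ?_ B.2
    exact (Finset.sup_le fun i _ => le_rfl : (t.sup fun _ : Unit => p) ≤ p) x
  have hle : ∀ x, q (M + 1) x ≤ B * C * q M x := by
    intro x
    refine (hB' x).trans ?_
    rw [mul_assoc]
    refine mul_le_mul_of_nonneg_left ((hC x).trans ?_) B.2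
    rw [smul_apply, NNReal.smul_def, smul_eq_mul]
    exact mul_le_mul_of_nonneg_left (hM x) C.2
  have h2 : Tendsto (fun n : ℕ => (((M : ℝ) + 2) / (M + 1)) ^ n) atTop atTop :=
    tendsto_pow_atTop_atTop_of_one_lt (by rw [one_lt_div (by positivity)]; linarith)
  obtain ⟨n, hn⟩ := (h2.eventually_gt_atTop (B * C : ℝ)).exists
  have h3 := hle (X 0 ^ n)
  rw [q_X_pow, q_X_pow] at h3
  rw [div_pow, lt_div_iff₀ (by positivity)] at hn
  push_cast at h3
  rw [show (M : ℝ) + 1 + 1 = M + 2 by ring] at h3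
  linarith

end TestAlgebra

/-! ### Multi-index binomial coefficients and Hasse derivatives -/

/-- The multi-index binomial coefficient `∏ᵢ (Aᵢ choose pᵢ)`, as a coefficient of
`∏ᵢ (1 + Xᵢ) ^ Aᵢ`. -/
noncomputable def multiChoose (A p : ℕ →₀ ℕ) : ℂ :=
  MvPolynomial.coeff p (A.prod fun i n => (1 + MvPolynomial.X i : MvPolynomial ℕ ℂ) ^ n)

theorem multiChoose_zero (p : ℕ →₀ ℕ) : multiChoose 0 p = if 0 = p then 1 else 0 := by
  classical
  simp [multiChoose, MvPolynomial.coeff_one]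

theorem multiChoose_single (i : ℕ) (p : ℕ →₀ ℕ) : multiChoose (Finsupp.single i 1) p =
    (if 0 = p then 1 else 0) + if Finsupp.single i 1 = p then 1 else 0 := by
  classical
  simp [multiChoose, MvPolynomial.coeff_one, MvPolynomial.coeff_X]

/-- Vandermonde's identity, read off from `(1 + X) ^ (A + B) = (1 + X) ^ A (1 + X) ^ B`. -/
theorem multiChoose_add (A B p : ℕ →₀ ℕ) : multiChoose (A + B) p =
    ∑ x ∈ Finset.HasAntidiagonal.antidiagonal p, multiChoose A x.1 * multiChoose B x.2 := by
  classical
  rw [multiChoose, Finsupp.prod_add_index' (by simp) (by intros; rw [pow_add]),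
    MvPolynomial.coeff_mul]
  rfl

theorem finsupp_induction_add {P : (ℕ →₀ ℕ) → Prop} (h0 : P 0)
    (h1 : ∀ i, P (Finsupp.single i 1)) (h2 : ∀ A B, P A → P B → P (A + B)) (A : ℕ →₀ ℕ) :
    P A := by
  refine Finsupp.induction_linear A h0 h2 fun i n => ?_
  induction n with
  | zero => simpa using h0
  | succ n ih => rw [Finsupp.single_add]; exact h2 _ _ ih (h1 i)

theorem le_of_multiChoose_ne_zero (A : ℕ →₀ ℕ) : ∀ p, multiChoose A p ≠ 0 → p ≤ A := by
  induction A using finsupp_induction_add with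
  | h0 =>
    intro p hp
    rw [multiChoose_zero] at hp
    by_cases h : 0 = p
    · rw [← h]
    · simp [h] at hp
  | h1 i =>
    intro p hp
    rw [multiChoose_single] at hp
    by_cases h : 0 = p
    · rw [← h]; exact zero_le
    · by_cases h' : Finsupp.single i 1 = p
      · rw [h']
      · simp [h, h'] at hp
  | h2 A B hA hB =>
    intro p hp
    rw [multiChoose_add] at hp
    obtain ⟨x, hx, hne⟩ := Finset.exists_ne_zero_of_sum_ne_zero hp
    rw [← Finset.HasAntidiagonal.mem_antidiagonal.mp hx]
    exact add_le_add (hA _ (left_ne_zero_of_mul hne)) (hB _ (right_ne_zero_of_mul hne))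

theorem multiChoose_self (A : ℕ →₀ ℕ) : multiChoose A A = 1 := by
  induction A using finsupp_induction_add with
  | h0 =>
    simp [multiChoose_zero]
  | h1 i =>
    rw [multiChoose_single]
    simp [eq_comm]
  | h2 A B hA hB =>
    rw [multiChoose_add, Finset.sum_eq_single (A, B), hA, hB, one_mul]
    · rintro ⟨p, q⟩ hx hne
      by_contra h
      have h1 := le_of_multiChoose_ne_zero _ _ (left_ne_zero_of_mul h)
      have h2 := le_of_multiChoose_ne_zero _ _ (right_ne_zero_of_mul h)
      have h3 : p + q = A + B := Finset.HasAntidiagonal.mem_antidiagonal.mp hx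
      simp only at h1 h2
      have h4 : p = A := le_antisymm h1 (le_of_add_le_add_right
        (h3.symm.le.trans (add_le_add_right h2 p)))
      have h5 : q = B := by rw [h4] at h3; exact add_left_cancel h3
      exact hne (by rw [h4, h5])
    · intro h
      rw [Finset.HasAntidiagonal.mem_antidiagonal] at h
      exact absurd rfl h

theorem multiChoose_zero_right (A : ℕ →₀ ℕ) : multiChoose A 0 = 1 := by
  induction A using finsupp_induction_add with
  | h0 =>
    simp [multiChoose_zero]
  | h1 i =>
    rw [multiChoose_single]
    simp
  | h2 A B hA hB =>
    rw [multiChoose_add]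
    simp [hA, hB]

namespace MvPowerSeries

/-- The Hasse derivative `∑ₛ (r + s choose r) α_{r + s} Xˢ` of `∑ₛ αₛ Xˢ`. -/
noncomputable def hasse (r : ℕ →₀ ℕ) : MvPowerSeries ℕ ℂ →ₗ[ℂ] MvPowerSeries ℕ ℂ where
  toFun f := fun s => multiChoose (r + s) r * coeff (r + s) f
  map_add' f g := by
    ext s
    exact mul_add _ _ _
  map_smul' c f := by
    ext s
    exact mul_left_comm _ _ _

theorem coeff_hasse (r s : ℕ →₀ ℕ) (f : MvPowerSeries ℕ ℂ) :
    coeff s (hasse r f) = multiChoose (r + s) r * coeff (r + s) f := rfl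

theorem constantCoeff_hasse (r : ℕ →₀ ℕ) (f : MvPowerSeries ℕ ℂ) :
    constantCoeff (hasse r f) = coeff r f := by
  rw [← coeff_zero_eq_constantCoeff_apply, coeff_hasse, add_zero, multiChoose_self, one_mul]

theorem hasse_zero (f : MvPowerSeries ℕ ℂ) : hasse 0 f = f := by
  ext s
  rw [coeff_hasse, multiChoose_zero_right, zero_add, one_mul]

/-- The higher Leibniz rule is Vandermonde's identity applied to each coefficient of the product. -/
theorem hasse_mul (r : ℕ →₀ ℕ) (f g : MvPowerSeries ℕ ℂ) :
    hasse r (f * g) =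
      ∑ x ∈ Finset.HasAntidiagonal.antidiagonal r, hasse x.1 f * hasse x.2 g := by
  classical
  ext s
  rw [coeff_hasse, coeff_mul, map_sum, Finset.mul_sum]
  trans ∑ y ∈ Finset.HasAntidiagonal.antidiagonal (r + s),
    ∑ x ∈ Finset.HasAntidiagonal.antidiagonal r,
      (multiChoose y.1 x.1 * coeff y.1 f) * (multiChoose y.2 x.2 * coeff y.2 g)
  · refine Finset.sum_congr rfl fun y hy => ?_
    rw [← Finset.HasAntidiagonal.mem_antidiagonal.mp hy, multiChoose_add, Finset.sum_mul]
    refine Finset.sum_congr rfl fun x _ => by ring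
  rw [Finset.sum_comm]
  refine Finset.sum_congr rfl fun x hx => ?_
  have hx' := Finset.HasAntidiagonal.mem_antidiagonal.mp hx
  rw [coeff_mul]
  symm
  -- Pairs `(a, b)` not of the form `(x.1 + c, x.2 + d)` drop out because one of their binomial
  -- coefficients vanishes.
  refine Finset.sum_of_injOn (fun z => (x.1 + z.1, x.2 + z.2)) ?_ ?_ ?_ ?_
  · rintro ⟨a, b⟩ - ⟨a', b'⟩ - h
    simpa using h
  · rintro ⟨a, b⟩ h
    have h' : a + b = s := by simpa using h
    simp only [Finset.mem_coe, Finset.HasAntidiagonal.mem_antidiagonal]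
    rw [← hx', ← h', add_add_add_comm]
  · rintro ⟨a, b⟩ h hn
    by_contra hne
    have h1 : x.1 ≤ a :=
      le_of_multiChoose_ne_zero _ _ (left_ne_zero_of_mul (left_ne_zero_of_mul hne))
    have h2 : x.2 ≤ b :=
      le_of_multiChoose_ne_zero _ _ (left_ne_zero_of_mul (right_ne_zero_of_mul hne))
    obtain ⟨c, rfl⟩ := exists_add_of_le h1
    obtain ⟨d, rfl⟩ := exists_add_of_le h2
    refine hn ⟨(c, d), ?_, rfl⟩
    have h3 : x.1 + c + (x.2 + d) = r + s := Finset.HasAntidiagonal.mem_antidiagonal.mp h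
    rw [add_add_add_comm, hx'] at h3
    simpa using add_left_cancel h3
  · rintro ⟨a, b⟩ -
    rfl

/-! ### Finite-rank quadratic parts and the wild derivation -/

/-- The row `(α_{2a+2, 2b+3})_b` of the matrix of mixed quadratic coefficients. -/
noncomputable def quadRow (f : MvPowerSeries ℕ ℂ) (a b : ℕ) : ℂ :=
  coeff (Finsupp.single (2 * a + 2) 1 + Finsupp.single (2 * b + 3) 1) f

theorem coeff_single_add_single_mul {i j : ℕ} (hij : i ≠ j) (f g : MvPowerSeries ℕ ℂ) :
    coeff (Finsupp.single i 1 + Finsupp.single j 1) (f * g) =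
      constantCoeff f * coeff (Finsupp.single i 1 + Finsupp.single j 1) g
      + coeff (Finsupp.single i 1) f * coeff (Finsupp.single j 1) g
      + coeff (Finsupp.single j 1) f * coeff (Finsupp.single i 1) g
      + coeff (Finsupp.single i 1 + Finsupp.single j 1) f * constantCoeff g := by
  have h1 : ∀ (i : ℕ) (h : MvPowerSeries ℕ ℂ),
      coeff (Finsupp.single i 1) h = constantCoeff (pderiv ℂ i h) := by
    intro i h
    rw [← coeff_zero_eq_constantCoeff_apply, coeff_pderiv]
    simp
  have h2 : ∀ h : MvPowerSeries ℕ ℂ, coeff (Finsupp.single i 1 + Finsupp.single j 1) h =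
      constantCoeff (pderiv ℂ i (pderiv ℂ j h)) := by
    intro h
    rw [← h1, coeff_pderiv]
    simp [hij]
  simp only [h2, h1, Derivation.leibniz, map_add, smul_eq_mul, map_mul]
  ring

/-- The series whose matrix of mixed quadratic coefficients has finite rank. -/
noncomputable def finiteRank : Submodule ℂ (MvPowerSeries ℕ ℂ) where
  carrier := {f | ∃ V : Submodule ℂ (ℕ → ℂ), FiniteDimensional ℂ V ∧ ∀ a, quadRow f a ∈ V}
  zero_mem' := ⟨⊥, inferInstance, fun a => by
    rw [Submodule.mem_bot]
    ext b
    simp [quadRow]⟩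
  add_mem' := by
    rintro f g ⟨V, hV, hf⟩ ⟨V', hV', hg⟩
    refine ⟨V ⊔ V', inferInstance, fun a => ?_⟩
    have : quadRow (f + g) a = quadRow f a + quadRow g a := by
      ext b
      simp [quadRow]
    rw [this]
    exact Submodule.add_mem_sup (hf a) (hg a)
  smul_mem' := by
    rintro c f ⟨V, hV, hf⟩
    refine ⟨V, hV, fun a => ?_⟩
    have : quadRow (c • f) a = c • quadRow f a := by
      ext b
      simp [quadRow]
    rw [this]
    exact V.smul_mem c (hf a)

theorem mem_finiteRank_of_coeff_eq_zero {f : MvPowerSeries ℕ ℂ}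
    (hf : ∀ a b, coeff (Finsupp.single (2 * a + 2) 1 + Finsupp.single (2 * b + 3) 1) f = 0) :
    f ∈ finiteRank :=
  ⟨⊥, inferInstance, fun a => by
    rw [Submodule.mem_bot]
    ext b
    exact hf a b⟩

/-- Without constant terms, the mixed quadratic coefficients of a product come only from the two
linear parts, so every row is a combination of two fixed vectors. -/
theorem mul_mem_finiteRank {f g : MvPowerSeries ℕ ℂ} (hf : constantCoeff f = 0)
    (hg : constantCoeff g = 0) : f * g ∈ finiteRank := by
  let F : (MvPowerSeries ℕ ℂ) → ℕ → ℂ := fun h b => coeff (Finsupp.single (2 * b + 3) 1) h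
  refine ⟨Submodule.span ℂ {F f, F g}, FiniteDimensional.span_of_finite ℂ (by simp),
    fun a => ?_⟩
  rw [Submodule.mem_span_pair]
  refine ⟨coeff (Finsupp.single (2 * a + 2) 1) g, coeff (Finsupp.single (2 * a + 2) 1) f, ?_⟩
  ext b
  rw [quadRow, coeff_single_add_single_mul (by omega), hf, hg]
  simp only [Pi.add_apply, Pi.smul_apply, smul_eq_mul, F]
  ring

theorem one_mem_finiteRank : (1 : MvPowerSeries ℕ ℂ) ∈ finiteRank := by
  classical
  refine mem_finiteRank_of_coeff_eq_zero fun a b => ?_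
  rw [coeff_one, if_neg]
  intro h
  have := DFunLike.congr_fun h (2 * a + 2)
  simp at this

/-- The exponents of the monomials `X_{2i+2} X_{2i+3}`. -/
noncomputable def diagExponent (i : ℕ) : ℕ →₀ ℕ := Finsupp.single (2 * i + 2) 1 + Finsupp.single (2 * i + 3) 1

theorem diagExponent_injective : Function.Injective diagExponent := by
  intro i j h
  by_contra hne
  have h1 := DFunLike.congr_fun h (2 * i + 2)
  simp only [diagExponent, Finsupp.add_apply, Finsupp.single_apply] at h1
  split_ifs at h1 <;> omega

/-- The quadratic form `∑ᵢ 2⁻ⁱ X_{2i+2} X_{2i+3}` of infinite rank. -/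
noncomputable def diagForm : MvPowerSeries ℕ ℂ := Function.extend diagExponent (fun i => (1 / 2 : ℂ) ^ i) 0

theorem coeff_diagForm (i : ℕ) : coeff (diagExponent i) diagForm = (1 / 2 : ℂ) ^ i :=
  diagExponent_injective.extend_apply _ _ i

theorem coeff_diagForm_of_notMem {r : ℕ →₀ ℕ} (hr : r ∉ Set.range diagExponent) :
    coeff r diagForm = 0 :=
  Function.extend_apply' _ _ _ hr

/-- The matrix is diagonal with nonzero entries, so its rows would put infinitely many independent
unit vectors into a finite-dimensional space. -/
theorem diagForm_notMem_finiteRank : diagForm ∉ finiteRank := by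
  classical
  rintro ⟨V, hV, h⟩
  have h1 : ∀ a, (Pi.single a 1 : ℕ → ℂ) ∈ V := by
    intro a
    have h2 : quadRow diagForm a = ((1 / 2 : ℂ) ^ a) • (Pi.single a 1 : ℕ → ℂ) := by
      ext b
      by_cases hab : b = a
      · subst hab
        rw [quadRow, ← diagExponent, coeff_diagForm]
        simp
      · rw [quadRow, coeff_diagForm_of_notMem]
        · simp [hab]
        · rintro ⟨i, hi⟩
          have h3 := DFunLike.congr_fun hi (2 * a + 2)
          have h4 := DFunLike.congr_fun hi (2 * b + 3)
          simp only [diagExponent, Finsupp.add_apply, Finsupp.single_apply] at h3 h4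
          split_ifs at h3 h4 <;> omega
    have h5 := h a
    rw [h2] at h5
    exact (V.smul_mem_iff (pow_ne_zero a (by norm_num))).mp h5
  have h2 : LinearIndependent ℂ (fun a : ℕ => (⟨Pi.single a 1, h1 a⟩ : V)) :=
    LinearIndependent.of_comp V.subtype (Pi.linearIndependent_single_one ℕ ℂ)
  exact not_finite_iff_infinite.mpr inferInstance h2.finite

/-- Any functional killing `finiteRank` is a point derivation at the origin, since that space
contains `1` and all products of series without constant term. Linear algebra supplies one that is
nonzero on `diagForm`. -/
theorem exists_point_derivation : ∃ l : MvPowerSeries ℕ ℂ →ₗ[ℂ] ℂ,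
    (∀ f g, l (f * g) = constantCoeff f * l g + l f * constantCoeff g) ∧
    (∀ f ∈ finiteRank, l f = 0) ∧ l diagForm ≠ 0 := by
  obtain ⟨l, hl, hW⟩ := Submodule.exists_le_ker_of_notMem diagForm_notMem_finiteRank
  have hW' : ∀ f ∈ finiteRank, l f = 0 := fun f hf => hW hf
  refine ⟨l, fun f g => ?_, hW', hl⟩
  have h1 := hW' _ (mul_mem_finiteRank (f := f - constantCoeff f • 1)
    (g := g - constantCoeff g • 1) (by simp) (by simp))
  have h2 := hW' _ one_mem_finiteRank
  have h3 : (f - constantCoeff f • 1) * (g - constantCoeff g • 1) =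
      f * g - constantCoeff f • g - constantCoeff g • f
        + (constantCoeff f * constantCoeff g) • (1 : MvPowerSeries ℕ ℂ) := by
    simp only [smul_eq_C_mul, map_mul]
    ring
  rw [h3] at h1
  simp only [map_add, map_sub, map_smul, h2, smul_eq_mul, mul_zero, add_zero] at h1
  linear_combination h1

/-- The weight that counts all indeterminates except `X₁`. -/
def wt (i : ℕ) : ℕ := if i = 1 then 0 else 1

/-- `D f = ∑ᵣ l(hasse r f) Xʳ` applies the point derivation `l` at a moving point. The Leibniz rules
of `hasse` and `l` combine into that of `D`. Since `l` ignores series with no mixed quadratic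
coefficients, it kills the Hasse derivatives of each `Xᵢ`, and it can lower weight only by the
weight `2` of such a monomial. -/
theorem exists_wild_derivation : ∃ D : MvPowerSeries ℕ ℂ →ₗ[ℂ] MvPowerSeries ℕ ℂ,
    (∀ f g, D (f * g) = f * D g + D f * g) ∧ (∀ i, D (X i) = 0) ∧
    (∀ (N : ℕ) (f : MvPowerSeries ℕ ℂ), (∀ r, Finsupp.weight wt r < N → coeff r f = 0) →
      ∀ r, Finsupp.weight wt r + 2 < N → coeff r (D f) = 0) ∧
    constantCoeff (D diagForm) ≠ 0 := by
  obtain ⟨l, hmul, hW, hu⟩ := exists_point_derivation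
  let D : MvPowerSeries ℕ ℂ →ₗ[ℂ] MvPowerSeries ℕ ℂ :=
    { toFun := fun f r => l (hasse r f)
      map_add' := fun f g => by
        ext r
        change l (hasse r (f + g)) = l (hasse r f) + l (hasse r g)
        simp
      map_smul' := fun c f => by
        ext r
        change l (hasse r (c • f)) = c • l (hasse r f)
        simp }
  have hD : ∀ r f, coeff r (D f) = l (hasse r f) := fun r f => rfl
  refine ⟨D, fun f g => ?_, fun i => ?_, fun N f hf r hr => ?_, ?_⟩
  · ext r
    rw [hD, hasse_mul, map_sum, map_add, coeff_mul, coeff_mul, ← Finset.sum_add_distrib]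
    refine Finset.sum_congr rfl fun x _ => ?_
    rw [hmul, constantCoeff_hasse, constantCoeff_hasse, hD, hD]
  · classical
    ext r
    rw [hD, hW, map_zero]
    refine mem_finiteRank_of_coeff_eq_zero fun a b => ?_
    rw [coeff_hasse, coeff_X, if_neg, mul_zero]
    intro h
    have := congrArg Finsupp.degree h
    simp at this
  · rw [hD, hW]
    refine mem_finiteRank_of_coeff_eq_zero fun a b => ?_
    rw [coeff_hasse, hf, mul_zero]
    simpa [Finsupp.weight_single, wt, map_add] using hr
  · rw [← coeff_zero_eq_constantCoeff_apply, hD, hasse_zero]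
    exact hu

end MvPowerSeries

/-! ### Comparing substitutions modulo powers of an indeterminate -/

namespace MvPowerSeries

section Subst

variable {σ τ R : Type*} [CommRing R] {a b : σ → MvPowerSeries τ R}

theorem exists_finset_coeff_subst (ha : HasSubst a) (e : τ →₀ ℕ) :
    ∃ F : Finset (σ →₀ ℕ), ∀ f g : MvPowerSeries σ R, (∀ d ∈ F, coeff d f = coeff d g) →
      coeff e (subst a f) = coeff e (subst a g) := by
  -- With all coefficients equal to `1`, the finite support contains every monomial that can
  -- contribute to the coefficient at `e`, whatever the series.
  let o : MvPowerSeries σ R := fun _ => 1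
  have hfin : (Function.support fun d => coeff d o • coeff e (d.prod fun s n => a s ^ n)).Finite :=
    coeff_subst_finite ha o e
  refine ⟨hfin.toFinset, fun f g h => ?_⟩
  rw [coeff_subst ha, coeff_subst ha]
  refine finsum_congr fun d => ?_
  by_cases hd : coeff e (d.prod fun s n => a s ^ n) = 0
  · rw [hd, smul_zero, smul_zero]
  · rw [h d]
    rw [Set.Finite.mem_toFinset, Function.mem_support]
    change (1 : R) • _ ≠ 0
    rwa [one_smul]

theorem exists_polynomial_coeff_eq (K : Finset (σ →₀ ℕ)) (f : MvPowerSeries σ R) :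
    ∃ p : MvPolynomial σ R, ∀ d ∈ K, coeff d f = coeff d (p : MvPowerSeries σ R) := by
  classical
  refine ⟨∑ d ∈ K, MvPolynomial.monomial d (coeff d f), fun d hd => ?_⟩
  rw [MvPolynomial.coeff_coe, MvPolynomial.coeff_sum]
  simp [MvPolynomial.coeff_monomial, hd]

/-- Induction handles polynomials; a coefficient of a substituted series depends on finitely many
coefficients, so the series may be replaced by a polynomial. -/
theorem dvd_subst_sub (ha : HasSubst a) (hb : HasSubst b) {j : τ} {k : ℕ}
    (h : ∀ i, X j ^ k ∣ a i - b i) (f : MvPowerSeries σ R) :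
    X j ^ k ∣ subst a f - subst b f := by
  classical
  have hp : ∀ p : MvPolynomial σ R,
      X j ^ k ∣ MvPolynomial.aeval a p - MvPolynomial.aeval b p := by
    intro p
    induction p using MvPolynomial.induction_on with
    | C r => simp
    | add p q hp hq =>
      rw [map_add, map_add, add_sub_add_comm]
      exact dvd_add hp hq
    | mul_X p i hp =>
      rw [map_mul, map_mul, MvPolynomial.aeval_X, MvPolynomial.aeval_X,
        show ∀ x y z t : MvPowerSeries τ R, x * y - z * t = (x - z) * y + z * (y - t) by
          intros; ring]
      exact dvd_add (dvd_mul_of_dvd_left hp _) (dvd_mul_of_dvd_right (h i) _)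
  rw [X_pow_dvd_iff]
  intro e he
  obtain ⟨F, hF⟩ := exists_finset_coeff_subst ha e
  obtain ⟨G, hG⟩ := exists_finset_coeff_subst hb e
  obtain ⟨p, hpK⟩ := exists_polynomial_coeff_eq (F ∪ G) f
  have h1 := X_pow_dvd_iff.mp (hp p) e he
  rw [← subst_coe, ← subst_coe] at h1
  rw [map_sub, hF f p fun d hd => hpK d (Finset.mem_union_left _ hd),
    hG f p fun d hd => hpK d (Finset.mem_union_right _ hd), ← map_sub, h1]

/-- First-order Taylor expansion in one variable: the remainder is a multiple of `h * h`. Again it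
is proved for polynomials and transferred coefficient by coefficient. -/
theorem dvd_subst_add_single [DecidableEq σ] {i : σ} {h : MvPowerSeries τ R} (hb : HasSubst b)
    (ha : HasSubst (b + Pi.single i h)) {j : τ} {k : ℕ} (hh : X j ^ k ∣ h * h)
    (f : MvPowerSeries σ R) :
    X j ^ k ∣ subst (b + Pi.single i h) f - subst b f - h * subst b (pderiv R i f) := by
  classical
  have hp : ∀ p : MvPolynomial σ R, X j ^ k ∣ MvPolynomial.aeval (b + Pi.single i h) p -
      MvPolynomial.aeval b p - h * MvPolynomial.aeval b (MvPolynomial.pderiv i p) := by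
    intro p
    induction p using MvPolynomial.induction_on with
    | C r => simp
    | add p q hp hq =>
      simp only [map_add]
      convert dvd_add hp hq using 1
      ring
    | mul_X p l hp =>
      have hl : ∃ c : MvPowerSeries τ R, (Pi.single i h : σ → MvPowerSeries τ R) l = h * c ∧
          MvPolynomial.aeval b (MvPolynomial.pderiv i (MvPolynomial.X l : MvPolynomial σ R))
            = c := by
        by_cases hil : l = i
        · subst hil
          exact ⟨1, by simp⟩
        · refine ⟨0, by simp [hil], by simp [MvPolynomial.pderiv_X_of_ne hil]⟩
      obtain ⟨c, hc, hc'⟩ := hl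
      rw [MvPolynomial.pderiv_mul]
      simp only [map_mul, map_add, MvPolynomial.aeval_X, Pi.add_apply, hc, hc']
      obtain ⟨u, hu⟩ := hp
      obtain ⟨v, hv⟩ := hh
      refine ⟨u * (b l + h * c) +
        v * c * MvPolynomial.aeval b (MvPolynomial.pderiv i p), ?_⟩
      linear_combination (b l + h * c) * hu +
        c * MvPolynomial.aeval b (MvPolynomial.pderiv i p) * hv
  rw [X_pow_dvd_iff]
  intro e he
  obtain ⟨F, hF⟩ := exists_finset_coeff_subst ha e
  choose G hG using fun e => exists_finset_coeff_subst hb e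
  -- Coefficients of `f` entering the derivative term sit one step higher in direction `i`.
  let H : Finset (σ →₀ ℕ) := (Finset.HasAntidiagonal.antidiagonal e).biUnion fun x =>
    (G x.2).image fun d => d + Finsupp.single i 1
  obtain ⟨p, hpK⟩ := exists_polynomial_coeff_eq (F ∪ (G e ∪ H)) f
  have h1 := X_pow_dvd_iff.mp (hp p) e he
  rw [← subst_coe, ← subst_coe, ← subst_coe, ← pderiv_coe] at h1
  rw [← h1, map_sub, map_sub, map_sub, map_sub,
    hF f p fun d hd => hpK d (Finset.mem_union_left _ hd),
    hG e f p fun d hd => hpK d (Finset.mem_union_right _ (Finset.mem_union_left _ hd)),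
    coeff_mul, coeff_mul]
  refine congrArg _ (Finset.sum_congr rfl fun x hx => ?_)
  rw [hG x.2 (pderiv R i f) (pderiv R i p) fun d hd => ?_]
  rw [coeff_pderiv, coeff_pderiv, hpK]
  exact Finset.mem_union_right _ (Finset.mem_union_right _ (Finset.mem_biUnion.mpr
    ⟨x, hx, Finset.mem_image_of_mem _ hd⟩))

end Subst

/-! ### The lacunary images of the indeterminates -/

/-- The partial sums `S_s = 1 + ∑_{t < s} c_t` of the rapidly growing sequence `c_s = s S_s ^ s`. -/
def growthSum : ℕ → ℕ
  | 0 => 1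
  | s + 1 => growthSum s + s * growthSum s ^ s

/-- The rapidly growing sequence `c_s = s S_s ^ s`, where `S_s = 1 + ∑_{t < s} c_t`. -/
def growth (s : ℕ) : ℕ := s * growthSum s ^ s

theorem growthSum_succ (s : ℕ) : growthSum (s + 1) = growthSum s + growth s := rfl

theorem one_le_growthSum (s : ℕ) : 1 ≤ growthSum s := by
  induction s with
  | zero => exact le_rfl
  | succ s ih => rw [growthSum_succ]; omega

/-- The index `≥ 2` of the indeterminate to which the `s`-th term is assigned; every index is
attained infinitely often. -/
def assigned (s : ℕ) : ℕ := (Nat.unpair s).1 + 2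

/-- The images of the indeterminates, with the lacunary series truncated after `s` terms. -/
noncomputable def truncImage : ℕ → ℕ → MvPolynomial (Fin 2) ℕ
  | 0 => fun i => if i = 0 then MvPolynomial.X 0 else if i = 1 then MvPolynomial.X 1 else 0
  | s + 1 => truncImage s + Pi.single (assigned s)
      (MvPolynomial.monomial (Finsupp.single 0 1 + Finsupp.single 1 (s ^ 2)) (growth s))

theorem truncImage_zero_right (s : ℕ) : truncImage s 0 = MvPolynomial.X 0 := by
  induction s with
  | zero => simp [truncImage]
  | succ s ih => simp [truncImage, ih, assigned]

theorem truncImage_one_right (s : ℕ) : truncImage s 1 = MvPolynomial.X 1 := by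
  induction s with
  | zero => simp [truncImage]
  | succ s ih => simp [truncImage, ih, assigned]

theorem truncImage_eq_zero {s i : ℕ} (hi : 2 ≤ i) (h : ∀ t < s, assigned t ≠ i) :
    truncImage s i = 0 := by
  induction s with
  | zero => simp [truncImage, show i ≠ 0 by omega, show i ≠ 1 by omega]
  | succ s ih =>
    simp [truncImage, ih fun t ht => h t (by omega), (h s (by omega)).symm]

/-- Evaluation at `1` adds the coefficients; for `i ≥ 2` these are some of the `c_t` with `t < s`,
whose total is below `S_s`. The exponent `wt i` makes the bound multiplicative over monomials. -/
theorem eval_truncImage_le (s i : ℕ) :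
    MvPolynomial.eval 1 (truncImage s i) ≤ growthSum s ^ wt i := by
  rcases Nat.lt_or_ge i 2 with hi | hi
  · interval_cases i
    · simpa [truncImage_zero_right, wt] using one_le_growthSum s
    · simp [truncImage_one_right, wt]
  rw [wt, if_neg (by omega), pow_one]
  induction s with
  | zero => simp [truncImage, show i ≠ 0 by omega, show i ≠ 1 by omega]
  | succ s ih =>
    rw [truncImage, growthSum_succ, Pi.add_apply, map_add]
    refine add_le_add ih ?_
    by_cases h : i = assigned s
    · subst h
      simp [MvPolynomial.eval_monomial]
    · simp [h]

theorem coeff_le_eval_one (p : MvPolynomial (Fin 2) ℕ) (e : Fin 2 →₀ ℕ) :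
    MvPolynomial.coeff e p ≤ MvPolynomial.eval 1 p := by
  rw [MvPolynomial.eval_eq]
  by_cases h : e ∈ p.support
  · simpa using Finset.single_le_sum (f := fun e => MvPolynomial.coeff e p)
      (fun _ _ => Nat.zero_le _) h
  · rw [MvPolynomial.notMem_support_iff.mp h]
    exact Nat.zero_le _

theorem coeff_prod_truncImage_le (s : ℕ) (d : ℕ →₀ ℕ) (e : Fin 2 →₀ ℕ) :
    MvPolynomial.coeff e (d.prod fun i n => truncImage s i ^ n) ≤
      growthSum s ^ Finsupp.weight wt d := by
  refine (coeff_le_eval_one _ e).trans ?_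
  rw [Finsupp.prod, map_prod, Finsupp.weight_apply, Finsupp.sum, ← Finset.prod_pow_eq_pow_sum]
  refine Finset.prod_le_prod' fun i _ => ?_
  rw [map_pow, smul_eq_mul, mul_comm, pow_mul]
  exact Nat.pow_le_pow_left (eval_truncImage_le s i) _

/-- Polynomials with natural coefficients as complex power series. -/
noncomputable def natToSeries : MvPolynomial (Fin 2) ℕ →+* MvPowerSeries (Fin 2) ℂ :=
  (MvPolynomial.coeToMvPowerSeries.ringHom).comp (MvPolynomial.map (Nat.castRingHom ℂ))

theorem coeff_natToSeries (p : MvPolynomial (Fin 2) ℕ) (e : Fin 2 →₀ ℕ) :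
    coeff e (natToSeries p) = ((MvPolynomial.coeff e p : ℕ) : ℂ) := by
  simp [natToSeries, MvPolynomial.coeff_map]

/-- The images of the indeterminates, truncated, as complex power series. -/
noncomputable def truncSeries (s i : ℕ) : MvPowerSeries (Fin 2) ℂ := natToSeries (truncImage s i)

theorem truncSeries_succ (s : ℕ) : truncSeries (s + 1) = truncSeries s +
    Pi.single (assigned s)
      (monomial (Finsupp.single 0 1 + Finsupp.single 1 (s ^ 2)) (growth s : ℂ)) := by
  classical
  ext i e
  rw [truncSeries, truncImage, Pi.add_apply, Pi.add_apply, map_add, map_add, map_add,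
    truncSeries]
  congr 1
  rw [coeff_natToSeries]
  by_cases h : i = assigned s
  · subst h
    simp [coeff_monomial, MvPolynomial.coeff_monomial, eq_comm]
  · simp [h]

theorem coeff_truncSeries_of_lt {s t : ℕ} (hst : s ≤ t) (i : ℕ) {e : Fin 2 →₀ ℕ}
    (he : e 1 < s ^ 2) : coeff e (truncSeries t i) = coeff e (truncSeries s i) := by
  classical
  induction t, hst using Nat.le_induction with
  | base => rfl
  | succ t hst ih =>
    rw [truncSeries_succ, Pi.add_apply, map_add, ih]
    by_cases h : i = assigned t
    · subst h
      rw [Pi.single_eq_same, coeff_monomial, if_neg, add_zero]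
      rintro rfl
      have := Nat.pow_le_pow_left hst 2
      simp at he
      omega
    · simp [h]

/-- The images of the indeterminates: `X₀ ↦ x₁`, `X₁ ↦ x₂`, and `Xᵢ ↦ x₁ φᵢ(x₂)` for `i ≥ 2`, where
`φᵢ` is the sum of `c_s x₂ ^ (s ^ 2)` over the `s` assigned to `i`. -/
noncomputable def imageSeries (i : ℕ) : MvPowerSeries (Fin 2) ℂ :=
  fun e => coeff e (truncSeries (e 1 + 1) i)

theorem coeff_imageSeries {s i : ℕ} {e : Fin 2 →₀ ℕ} (he : e 1 < s ^ 2) :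
    coeff e (imageSeries i) = coeff e (truncSeries s i) := by
  have h0 : coeff e (imageSeries i) = coeff e (truncSeries (e 1 + 1) i) := rfl
  have h1 : e 1 < (e 1 + 1) ^ 2 := by nlinarith
  rw [h0]
  rcases le_total s (e 1 + 1) with h | h
  · exact coeff_truncSeries_of_lt h i he
  · exact (coeff_truncSeries_of_lt h i h1).symm

theorem dvd_imageSeries_sub (s i : ℕ) : X 1 ^ s ^ 2 ∣ imageSeries i - truncSeries s i := by
  rw [X_pow_dvd_iff]
  intro e he
  rw [map_sub, coeff_imageSeries he, sub_self]

theorem imageSeries_zero : imageSeries 0 = X 0 := by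
  ext e
  rw [coeff_imageSeries (s := e 1 + 1) (by nlinarith), truncSeries, truncImage_zero_right]
  simp [natToSeries]

theorem imageSeries_one : imageSeries 1 = X 1 := by
  ext e
  rw [coeff_imageSeries (s := e 1 + 1) (by nlinarith), truncSeries, truncImage_one_right]
  simp [natToSeries]

/-- The weight on `ℂ[[x₁, x₂]]` that counts `x₁` only. -/
def wt₂ (i : Fin 2) : ℕ := if i = 0 then 1 else 0

theorem weight_wt₂ (e : Fin 2 →₀ ℕ) : Finsupp.weight wt₂ e = e 0 := by
  simp [Finsupp.weight_apply, Finsupp.sum_fintype, wt₂]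

theorem isWeightedHomogeneous_truncSeries (s i : ℕ) :
    (truncSeries s i).IsWeightedHomogeneous wt₂ (wt i) := by
  classical
  induction s with
  | zero =>
    intro e he
    rw [truncSeries, coeff_natToSeries] at he
    rw [weight_wt₂]
    have h0 : ∀ j : Fin 2, MvPolynomial.coeff e (MvPolynomial.X j : MvPolynomial (Fin 2) ℕ) ≠ 0 →
        e = Finsupp.single j 1 := by
      intro j hj
      rw [MvPolynomial.coeff_X] at hj
      by_contra h
      exact hj (by simp [Ne.symm h])
    rcases i with _ | _ | i
    · rw [truncImage_zero_right] at he
      rw [h0 0 (by exact_mod_cast he)]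
      simp [wt]
    · rw [truncImage_one_right] at he
      rw [h0 1 (by exact_mod_cast he)]
      simp [wt]
    · simp [truncImage] at he
  | succ s ih =>
    rw [truncSeries_succ]
    refine ih.add ?_
    intro e he
    by_cases h : i = assigned s
    · subst h
      rw [Pi.single_eq_same, coeff_monomial] at he
      rw [weight_wt₂]
      by_cases h' : e = Finsupp.single 0 1 + Finsupp.single 1 (s ^ 2)
      · rw [h']
        simp [wt, assigned]
      · simp [h'] at he
    · simp [h] at he

theorem isWeightedHomogeneous_imageSeries (i : ℕ) :
    (imageSeries i).IsWeightedHomogeneous wt₂ (wt i) := by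
  intro e he
  rw [coeff_imageSeries (s := e 1 + 1) (by nlinarith)] at he
  exact isWeightedHomogeneous_truncSeries (e 1 + 1) i he

theorem constantCoeff_truncSeries (s i : ℕ) : constantCoeff (truncSeries s i) = 0 := by
  classical
  rw [← coeff_zero_eq_constantCoeff_apply]
  induction s with
  | zero =>
    rcases i with _ | _ | i
    · simp [truncSeries, coeff_natToSeries, truncImage]
    · simp [truncSeries, coeff_natToSeries, truncImage]
    · simp [truncSeries, truncImage]
  | succ s ih =>
    rw [truncSeries_succ, Pi.add_apply, map_add, ih, zero_add]
    by_cases h : i = assigned s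
    · subst h
      rw [Pi.single_eq_same, coeff_monomial, if_neg]
      intro h
      have := DFunLike.congr_fun h 0
      simp at this
    · simp [h]

theorem truncSeries_finite (s : ℕ) : {i | truncSeries s i ≠ 0}.Finite := by
  refine (((Finset.range s).image assigned ∪ {0, 1}).finite_toSet).subset fun i hi => ?_
  by_contra h
  simp only [Finset.mem_coe, Finset.mem_union, Finset.mem_image, Finset.mem_range,
    Finset.mem_insert, Finset.mem_singleton, not_or, not_exists, not_and] at h
  refine hi ?_
  rw [truncSeries, truncImage_eq_zero (by omega) fun t ht => h.1 t ht, map_zero]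

theorem hasSubst_truncSeries (s : ℕ) : HasSubst (truncSeries s) where
  const_coeff i := by
    rw [constantCoeff_truncSeries]
    exact IsNilpotent.zero
  coeff_zero e := (truncSeries_finite s).subset fun i hi h => hi (by rw [h, map_zero])

/-- A coefficient at `e` sees only the first `e 1 + 1` stages, which involve finitely many
indeterminates. -/
theorem hasSubst_imageSeries : HasSubst imageSeries where
  const_coeff i := by
    rw [← coeff_zero_eq_constantCoeff_apply, coeff_imageSeries (s := 1) (by simp),
      coeff_zero_eq_constantCoeff_apply, constantCoeff_truncSeries]
    exact IsNilpotent.zero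
  coeff_zero e := (truncSeries_finite (e 1 + 1)).subset fun i hi h => by
    rw [Set.mem_ofPred_eq, coeff_imageSeries (s := e 1 + 1) (by nlinarith), h, map_zero] at hi
    exact hi rfl

end MvPowerSeries

/-! ### Injectivity of the substitution on homogeneous elements of `𝒰` -/

namespace MvPowerSeries

theorem mem_testSubalgebra {f : MvPowerSeries ℕ ℂ} : f ∈ testSubalgebra ↔
    ∀ m : ℕ, Summable fun r : ℕ →₀ ℕ => ‖coeff r f‖ * ((m : ℝ) + 1) ^ r.degree := Iff.rfl

theorem summable_norm_coeff {f : MvPowerSeries ℕ ℂ} (hf : f ∈ testSubalgebra) :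
    Summable fun r : ℕ →₀ ℕ => ‖coeff r f‖ := by
  simpa using mem_testSubalgebra.mp hf 0

theorem pderiv_mem_testSubalgebra {f : MvPowerSeries ℕ ℂ} (hf : f ∈ testSubalgebra) (i : ℕ) :
    pderiv ℂ i f ∈ testSubalgebra := by
  rw [mem_testSubalgebra]
  intro m
  -- Index `2 * m + 1` means weight `2 (m + 1)`; the extra factor `2 ^ (|r| + 1)` absorbs the factor
  -- `r i + 1` from differentiation.
  have h1 := (mem_testSubalgebra.mp hf (2 * m + 1)).comp_injective
    (add_left_injective (Finsupp.single i 1))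
  refine Summable.of_nonneg_of_le (fun r => by positivity) (fun r => ?_) h1
  have h2 : (r i + 1 : ℕ) ≤ 2 ^ (r.degree + 1) :=
    (Nat.succ_le_succ (Finsupp.le_degree i r)).trans Nat.lt_two_pow_self.le
  have h3 : ‖((r i : ℂ) + 1)‖ ≤ 2 ^ (r.degree + 1) := by
    rw [← Nat.cast_succ, Complex.norm_natCast]
    exact_mod_cast h2
  have h4 : ((m : ℝ) + 1) ^ r.degree ≤ (m + 1) ^ (r.degree + 1) :=
    pow_le_pow_right₀ (by simp) (Nat.le_succ _)
  rw [coeff_pderiv, norm_mul, Function.comp_apply, mul_assoc, map_add, Finsupp.degree_single,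
    show (((2 * m + 1 : ℕ) : ℝ) + 1) = 2 * (m + 1) by push_cast; ring, mul_pow]
  gcongr

theorem weightedHomogeneousComponent_mem_testSubalgebra {f : MvPowerSeries ℕ ℂ}
    (hf : f ∈ testSubalgebra) (N : ℕ) :
    weightedHomogeneousComponent wt N f ∈ testSubalgebra := by
  rw [mem_testSubalgebra]
  intro m
  refine Summable.of_nonneg_of_le (fun r => by positivity) (fun r => ?_)
    (mem_testSubalgebra.mp hf m)
  rw [coeff_weightedHomogeneousComponent]
  split_ifs
  · exact le_rfl
  · rw [norm_zero, zero_mul]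
    positivity

theorem isWeightedHomogeneous_prod_imageSeries (d : ℕ →₀ ℕ) :
    (d.prod fun i n => imageSeries i ^ n).IsWeightedHomogeneous wt₂ (Finsupp.weight wt d) := by
  classical
  induction d using finsupp_induction_add with
  | h0 =>
    intro e he
    rw [Finsupp.prod_zero_index, coeff_one] at he
    by_cases h : e = 0
    · simp [h]
    · simp [h] at he
  | h1 i =>
    rw [Finsupp.prod_single_index (h := fun i n => imageSeries i ^ n) (pow_zero _), pow_one,
      Finsupp.weight_single, one_smul]
    exact isWeightedHomogeneous_imageSeries i
  | h2 A B hA hB =>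
    rw [Finsupp.prod_add_index' (by simp) (by intros; rw [pow_add]), map_add]
    exact hA.mul hB

theorem coeff_subst_imageSeries_congr {f g : MvPowerSeries ℕ ℂ} {e : Fin 2 →₀ ℕ}
    (h : ∀ d, Finsupp.weight wt d = e 0 → coeff d f = coeff d g) :
    coeff e (subst imageSeries f) = coeff e (subst imageSeries g) := by
  rw [coeff_subst hasSubst_imageSeries, coeff_subst hasSubst_imageSeries]
  refine finsum_congr fun d => ?_
  by_cases hd : Finsupp.weight wt d = e 0
  · rw [h d hd]
  · rw [IsWeightedHomogeneous.coeff_eq_zero (isWeightedHomogeneous_prod_imageSeries d)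
      (by rw [weight_wt₂]; exact fun h => hd h.symm), smul_zero, smul_zero]

/-- Each monomial of weight `N` has image with coefficients at most `S_s ^ N`, so the `ℓ¹` norm of
`f` controls the sum. -/
theorem norm_coeff_subst_truncSeries_le {f : MvPowerSeries ℕ ℂ} {N : ℕ}
    (hf : f ∈ testSubalgebra) (hN : f.IsWeightedHomogeneous wt N) (s : ℕ) (e : Fin 2 →₀ ℕ) :
    ‖coeff e (subst (truncSeries s) f)‖ ≤
      (∑' d, ‖coeff d f‖) * (growthSum s : ℝ) ^ N := by
  have hfin := coeff_subst_finite (hasSubst_truncSeries s) f e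
  rw [coeff_subst (hasSubst_truncSeries s), finsum_eq_sum _ hfin, ← tsum_mul_right]
  refine (norm_sum_le _ _).trans (le_trans (Finset.sum_le_sum fun d _ => ?_)
    (((summable_norm_coeff hf).mul_right _).sum_le_tsum _ fun d _ => by positivity))
  rw [smul_eq_mul, norm_mul]
  by_cases hd : coeff d f = 0
  · simp [hd]
  refine mul_le_mul_of_nonneg_left ?_ (norm_nonneg _)
  have h1 : (d.prod fun i n => truncSeries s i ^ n) =
      natToSeries (d.prod fun i n => truncImage s i ^ n) := by
    simp [Finsupp.prod, truncSeries]
  rw [h1, coeff_natToSeries, Complex.norm_natCast, ← hN hd]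
  exact_mod_cast coeff_prod_truncImage_le s d e

/-- Stage `s` adds `h = c_s x₁ x₂ ^ (s²)` to one image. The quadratic error is divisible by `x₂ ^ (2
s²)`, out of reach since `s² + e 1 < 2 s²`. -/
theorem coeff_subst_truncSeries_succ {f : MvPowerSeries ℕ ℂ} {s : ℕ} {e : Fin 2 →₀ ℕ}
    (he : e 1 < s ^ 2) :
    coeff (Finsupp.single 0 1 + Finsupp.single 1 (s ^ 2) + e) (subst (truncSeries (s + 1)) f) =
      coeff (Finsupp.single 0 1 + Finsupp.single 1 (s ^ 2) + e) (subst (truncSeries s) f) +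
      growth s * coeff e (subst (truncSeries s) (pderiv ℂ (assigned s) f)) := by
  classical
  have h1 := hasSubst_truncSeries (s + 1)
  rw [truncSeries_succ] at h1
  have h2 : (X 1 : MvPowerSeries (Fin 2) ℂ) ^ (2 * s ^ 2) ∣
      monomial (Finsupp.single 0 1 + Finsupp.single 1 (s ^ 2)) (growth s : ℂ) *
        monomial (Finsupp.single 0 1 + Finsupp.single 1 (s ^ 2)) (growth s : ℂ) := by
    rw [X_pow_dvd_iff]
    intro m hm
    rw [monomial_mul_monomial, coeff_monomial, if_neg]
    rintro rfl
    simp at hm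
    omega
  have h3 := X_pow_dvd_iff.mp (dvd_subst_add_single (hasSubst_truncSeries s) h1 h2 f)
    (Finsupp.single 0 1 + Finsupp.single 1 (s ^ 2) + e) (by simp; omega)
  rw [← truncSeries_succ, map_sub, map_sub, coeff_add_monomial_mul] at h3
  linear_combination h3

theorem coeff_subst_imageSeries_eq {f : MvPowerSeries ℕ ℂ} {s : ℕ} {e : Fin 2 →₀ ℕ}
    (he : e 1 < s ^ 2) :
    coeff e (subst imageSeries f) = coeff e (subst (truncSeries s) f) := by
  have := X_pow_dvd_iff.mp (dvd_subst_sub hasSubst_imageSeries (hasSubst_truncSeries s)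
    (dvd_imageSeries_sub s) f) e he
  rwa [map_sub, sub_eq_zero] at this

theorem growth_le_of_subst_eq_zero {f : MvPowerSeries ℕ ℂ} {N s : ℕ}
    (hf : f ∈ testSubalgebra) (hN : f.IsWeightedHomogeneous wt N)
    (h0 : subst imageSeries f = 0) {e : Fin 2 →₀ ℕ} (he : e 1 < s) :
    growth s * ‖coeff e (subst imageSeries (pderiv ℂ (assigned s) f))‖ ≤
      (∑' d, ‖coeff d f‖) * (growthSum s : ℝ) ^ N := by
  have hs : s ≤ s ^ 2 := Nat.le_self_pow two_ne_zero s
  have h1 := coeff_subst_truncSeries_succ (f := f) (he.trans_le hs)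
  -- Here `s² + e 1 < (s + 1)²`, so stage `s + 1` already computes this coefficient of the full
  -- substitution.
  rw [← coeff_subst_imageSeries_eq (s := s + 1) (by simp; nlinarith), h0, map_zero,
    ← coeff_subst_imageSeries_eq (he.trans_le hs)] at h1
  refine le_trans (le_of_eq ?_) (norm_coeff_subst_truncSeries_le hf hN s
    (Finsupp.single 0 1 + Finsupp.single 1 (s ^ 2) + e))
  rw [← Complex.norm_natCast (growth s), ← norm_mul, ← norm_neg]
  congr 1
  linear_combination h1

theorem exists_growth_gt (i N m : ℕ) {C κ : ℝ} (hκ : 0 < κ) :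
    ∃ s, assigned s = i + 2 ∧ m < s ∧ C * (growthSum s : ℝ) ^ N < growth s * κ := by
  obtain ⟨k, hk⟩ := exists_nat_gt (C / κ)
  -- Pairing with `i` makes `s` assigned to `i + 2`; the second entry forces `s` to exceed `m`, `N`
  -- and `C / κ`.
  let s := Nat.pair i (max (max m.succ N) k)
  have h1 : max (max m.succ N) k ≤ s := Nat.right_le_pair _ _
  have h2 : m.succ ≤ s := ((le_max_left _ _).trans (le_max_left _ _)).trans h1
  have h3 : N ≤ s := ((le_max_right _ _).trans (le_max_left _ _)).trans h1
  have h4 : k ≤ s := (le_max_right _ _).trans h1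
  refine ⟨s, by simp [assigned, s], h2, ?_⟩
  have hS : (1 : ℝ) ≤ growthSum s := by exact_mod_cast one_le_growthSum s
  have h5 : C < s * κ := by
    rw [div_lt_iff₀ hκ] at hk
    exact hk.trans_le (by gcongr)
  calc C * (growthSum s : ℝ) ^ N < s * κ * (growthSum s : ℝ) ^ N := by
        have : (0 : ℝ) < (growthSum s : ℝ) ^ N := by positivity
        gcongr
    _ ≤ s * κ * (growthSum s : ℝ) ^ s := by
        gcongr
    _ = growth s * κ := by
        rw [growth]
        push_cast
        ring

/-- Such an `f` has the form `X₀ ^ N g(X₁)`, and `X₀`, `X₁` go to independent indeterminates. -/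
theorem eq_zero_of_subst_eq_zero_of_pderiv {f : MvPowerSeries ℕ ℂ} {N : ℕ}
    (hN : f.IsWeightedHomogeneous wt N) (h0 : subst imageSeries f = 0)
    (hf : ∀ i, pderiv ℂ (i + 2) f = 0) : f = 0 := by
  classical
  have hd : ∀ d, coeff d f ≠ 0 → d = Finsupp.single 0 N + Finsupp.single 1 (d 1) := by
    intro d hd
    have h1 : ∀ i, d (i + 2) = 0 := by
      intro i
      by_contra h
      have hle : Finsupp.single (i + 2) 1 ≤ d := by
        rw [Finsupp.single_le_iff]
        omega
      have h2 := coeff_pderiv (R := ℂ) (i := i + 2) f (d - Finsupp.single (i + 2) 1)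
      rw [hf, map_zero, tsub_add_cancel_of_le hle] at h2
      refine mul_ne_zero hd ?_ h2.symm
      exact Nat.cast_add_one_ne_zero _
    have h2 : d = Finsupp.single 0 (d 0) + Finsupp.single 1 (d 1) := by
      ext i
      rcases i with _ | _ | i
      · simp
      · simp
      · simp [h1]
    have h3 := hN hd
    rw [h2] at h3
    simp [Finsupp.weight_single, wt] at h3
    rw [h3] at h2
    exact h2
  ext d
  rw [map_zero]
  by_contra hne
  have hform := hd d hne
  have h1 := congrArg (coeff (Finsupp.single 0 N + Finsupp.single 1 (d 1))) h0
  rw [coeff_subst hasSubst_imageSeries, map_zero, finsum_eq_single _ d] at h1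
  · rw [hform, Finsupp.prod_add_index' (by simp) (by intros; rw [pow_add])] at h1
    simp [imageSeries_zero, imageSeries_one, X_pow_eq, monomial_mul_monomial] at h1
    rw [hform] at hne
    exact hne h1
  · intro d' hd'
    by_cases hne' : coeff d' f = 0
    · rw [hne', zero_smul]
    · have hform' := hd d' hne'
      have h1 : d 1 ≠ d' 1 := fun h => hd' (by rw [hform, hform', h])
      rw [hform', Finsupp.prod_add_index' (by simp) (by intros; rw [pow_add])]
      simp [imageSeries_zero, imageSeries_one, X_pow_eq, monomial_mul_monomial, coeff_monomial]
      intro h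
      have := DFunLike.congr_fun h 1
      simp at this
      exact absurd this h1

/-- For `i ≥ 2`, the growth estimate forces the image of `∂ᵢ f` to vanish; that derivative has
weight one less, so it is zero by induction. -/
theorem eq_zero_of_subst_imageSeries_eq_zero (N : ℕ) : ∀ f ∈ testSubalgebra,
    f.IsWeightedHomogeneous wt N → subst imageSeries f = 0 → f = 0 := by
  induction N with
  | zero =>
    intro f hf hN h0
    refine eq_zero_of_subst_eq_zero_of_pderiv hN h0 fun i => ?_
    ext d
    rw [coeff_pderiv, hN.coeff_eq_zero, zero_mul, map_zero]
    simp [Finsupp.weight_single, wt]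
  | succ N ih =>
    intro f hf hN h0
    refine eq_zero_of_subst_eq_zero_of_pderiv hN h0 fun i => ?_
    refine ih _ (pderiv_mem_testSubalgebra hf _) (fun {d} hd => ?_) ?_
    · rw [coeff_pderiv] at hd
      have := hN (left_ne_zero_of_mul hd)
      simpa [Finsupp.weight_single, wt] using this
    · by_contra hne
      obtain ⟨e, he⟩ : ∃ e, coeff e (subst imageSeries (pderiv ℂ (i + 2) f)) ≠ 0 := by
        by_contra! h
        exact hne (MvPowerSeries.ext fun e => by rw [h, map_zero])
      obtain ⟨s, hs, hes, hlt⟩ := exists_growth_gt i (N + 1) (e 1)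
        (C := ∑' d, ‖coeff d f‖) (norm_pos_iff.mpr he)
      have h1 := growth_le_of_subst_eq_zero hf hN h0 hes
      rw [hs] at h1
      exact absurd h1 (not_le.mpr hlt)

end MvPowerSeries

/-! ### Twisting the substitution by the exponential of a derivation -/

namespace MvPowerSeries

section Exponential

variable (D : Derivation ℂ (MvPowerSeries ℕ ℂ) (MvPowerSeries ℕ ℂ))

/-- The divided powers `Dʲ / j!` of a derivation. -/
noncomputable def divPow (j : ℕ) : MvPowerSeries ℕ ℂ →ₗ[ℂ] MvPowerSeries ℕ ℂ :=
  (j.factorial : ℂ)⁻¹ • (D : MvPowerSeries ℕ ℂ →ₗ[ℂ] MvPowerSeries ℕ ℂ) ^ j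

theorem divPow_zero (f : MvPowerSeries ℕ ℂ) : divPow D 0 f = f := by
  simp [divPow]

theorem divPow_succ (j : ℕ) (f : MvPowerSeries ℕ ℂ) :
    ((j + 1 : ℕ) : ℂ) • divPow D (j + 1) f = D (divPow D j f) := by
  have h1 : ((j + 1 : ℕ) : ℂ) ≠ 0 := Nat.cast_ne_zero.mpr (Nat.succ_ne_zero j)
  simp only [divPow, LinearMap.smul_apply, smul_smul, Nat.factorial_succ, Nat.cast_mul, mul_inv,
    pow_succ', Module.End.mul_apply, Derivation.coeFn_coe, Derivation.map_smul]
  rw [mul_inv_cancel_left₀ h1]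

theorem divPow_of_eq_zero {f : MvPowerSeries ℕ ℂ} (hf : D f = 0) {j : ℕ} (hj : j ≠ 0) :
    divPow D j f = 0 := by
  obtain ⟨j, rfl⟩ := Nat.exists_eq_succ_of_ne_zero hj
  simp [divPow, pow_succ, hf]

/-- After multiplication by `n + 1`, split as `x.1 + x.2` on the antidiagonal, both sides become the
derivation applied to the previous case. -/
theorem divPow_mul (n : ℕ) (f g : MvPowerSeries ℕ ℂ) : divPow D n (f * g) =
    ∑ x ∈ Finset.HasAntidiagonal.antidiagonal n, divPow D x.1 f * divPow D x.2 g := by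
  induction n with
  | zero => simp [divPow_zero]
  | succ n ih =>
    have h1 : ((n + 1 : ℕ) : ℂ) ≠ 0 := Nat.cast_ne_zero.mpr (Nat.succ_ne_zero n)
    refine smul_right_injective _ h1 ?_
    simp only
    rw [divPow_succ, ih, map_sum, Finset.smul_sum]
    have h2 : ∀ x ∈ Finset.HasAntidiagonal.antidiagonal (n + 1),
        ((n + 1 : ℕ) : ℂ) • (divPow D x.1 f * divPow D x.2 g) =
          ((x.1 : ℂ) • divPow D x.1 f) * divPow D x.2 g +
            divPow D x.1 f * ((x.2 : ℂ) • divPow D x.2 g) := by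
      intro x hx
      rw [← Finset.HasAntidiagonal.mem_antidiagonal.mp hx, Nat.cast_add, add_smul, smul_mul_assoc,
        mul_smul_comm]
    rw [Finset.sum_congr rfl h2, Finset.sum_add_distrib, Finset.Nat.sum_antidiagonal_succ,
      Finset.Nat.sum_antidiagonal_succ']
    simp only [divPow_succ, Nat.cast_zero, zero_smul, zero_mul, mul_zero, zero_add,
      Derivation.leibniz, smul_eq_mul]
    rw [← Finset.sum_add_distrib]
    refine Finset.sum_congr rfl fun x _ => by ring

/-- The terms `x₁ ^ (3 j) Φ(Dʲ f) / j!` of the twisted substitution. -/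
noncomputable def twistTerm (j : ℕ) : MvPowerSeries ℕ ℂ →ₗ[ℂ] MvPowerSeries (Fin 2) ℂ :=
  LinearMap.mulLeft ℂ (X 0 ^ (3 * j)) ∘ₗ (substAlgHom hasSubst_imageSeries).toLinearMap ∘ₗ
    divPow D j

theorem twistTerm_apply (j : ℕ) (f : MvPowerSeries ℕ ℂ) :
    twistTerm D j f = X 0 ^ (3 * j) * subst imageSeries (divPow D j f) := by
  simp [twistTerm]

theorem twistTerm_mul (n : ℕ) (f g : MvPowerSeries ℕ ℂ) : twistTerm D n (f * g) =
    ∑ x ∈ Finset.HasAntidiagonal.antidiagonal n, twistTerm D x.1 f * twistTerm D x.2 g := by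
  rw [twistTerm_apply, divPow_mul, ← substAlgHom_apply hasSubst_imageSeries, map_sum,
    Finset.mul_sum]
  refine Finset.sum_congr rfl fun x hx => ?_
  rw [← Finset.HasAntidiagonal.mem_antidiagonal.mp hx, map_mul, twistTerm_apply, twistTerm_apply,
    substAlgHom_apply, substAlgHom_apply]
  ring

theorem coeff_twistTerm_mul_twistTerm {j l : ℕ} {e : Fin 2 →₀ ℕ} (h : e 0 < j + l)
    (f g : MvPowerSeries ℕ ℂ) : coeff e (twistTerm D j f * twistTerm D l g) = 0 := by
  rw [twistTerm_apply, twistTerm_apply]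
  refine X_pow_dvd_iff.mp (Dvd.intro (subst imageSeries (divPow D j f) *
    subst imageSeries (divPow D l g)) ?_ :
      (X 0 : MvPowerSeries (Fin 2) ℂ) ^ (3 * j + 3 * l) ∣ _) e (by omega)
  ring

theorem coeff_twistTerm_of_lt {j : ℕ} {e : Fin 2 →₀ ℕ} (h : e 0 < 3 * j)
    (f : MvPowerSeries ℕ ℂ) : coeff e (twistTerm D j f) = 0 := by
  rw [twistTerm_apply]
  exact X_pow_dvd_iff.mp (dvd_mul_right _ _) e h

/-- The twisted substitution `f ↦ ∑ⱼ x₁ ^ (3 j) Φ(Dʲ f) / j!`, as a linear map. -/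
noncomputable def twistLinear : MvPowerSeries ℕ ℂ →ₗ[ℂ] MvPowerSeries (Fin 2) ℂ where
  toFun f := fun e => ∑ j ∈ Finset.range (e 0 + 1), coeff e (twistTerm D j f)
  map_add' f g := by
    ext e
    change ∑ j ∈ Finset.range (e 0 + 1), coeff e (twistTerm D j (f + g)) =
      ∑ j ∈ Finset.range (e 0 + 1), coeff e (twistTerm D j f) +
        ∑ j ∈ Finset.range (e 0 + 1), coeff e (twistTerm D j g)
    simp only [map_add, Finset.sum_add_distrib]
  map_smul' c f := by
    ext e
    change ∑ j ∈ Finset.range (e 0 + 1), coeff e (twistTerm D j (c • f)) =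
      c • ∑ j ∈ Finset.range (e 0 + 1), coeff e (twistTerm D j f)
    simp only [map_smul, Finset.smul_sum]

theorem coeff_twistLinear {M : ℕ} {e : Fin 2 →₀ ℕ} (h : e 0 < M) (f : MvPowerSeries ℕ ℂ) :
    coeff e (twistLinear D f) = coeff e (∑ j ∈ Finset.range M, twistTerm D j f) := by
  have h0 : coeff e (twistLinear D f) =
    ∑ j ∈ Finset.range (e 0 + 1), coeff e (twistTerm D j f) := rfl
  rw [h0, map_sum]
  refine Finset.sum_subset (Finset.range_mono h) fun j _ hj => ?_
  rw [Finset.mem_range] at hj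
  exact coeff_twistTerm_of_lt D (by omega) f

/-- The left side sums the products of terms over a triangle of indices, the right side over a
square; the remaining products are divisible by too high a power of `x₁`. -/
theorem twistLinear_mul (f g : MvPowerSeries ℕ ℂ) :
    twistLinear D (f * g) = twistLinear D f * twistLinear D g := by
  classical
  ext e
  have h1 : coeff e (twistLinear D f * twistLinear D g) =
      coeff e ((∑ j ∈ Finset.range (e 0 + 1), twistTerm D j f) *
        ∑ j ∈ Finset.range (e 0 + 1), twistTerm D j g) := by
    rw [coeff_mul, coeff_mul]
    refine Finset.sum_congr rfl fun x hx => ?_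
    have hx' := DFunLike.congr_fun (Finset.HasAntidiagonal.mem_antidiagonal.mp hx) 0
    rw [Finsupp.add_apply] at hx'
    rw [coeff_twistLinear D (M := e 0 + 1) (by omega), coeff_twistLinear D (M := e 0 + 1) (by omega)]
  rw [h1, coeff_twistLinear D (Nat.lt_succ_self _), Finset.sum_mul_sum]
  simp only [twistTerm_mul, map_sum]
  simp only [Finset.Nat.sum_antidiagonal_eq_sum_range_succ
    (fun j l => coeff e (twistTerm D j f * twistTerm D l g)), Nat.succ_eq_add_one]
  rw [Finset.sum_range_diag_flip (e 0 + 1)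
    (fun j l => coeff e (twistTerm D j f * twistTerm D l g))]
  refine Finset.sum_congr rfl fun j hj => Finset.sum_subset (Finset.range_mono (by omega))
    fun l _ hl => ?_
  rw [Finset.mem_range] at hj hl
  exact coeff_twistTerm_mul_twistTerm D (by omega) f g

theorem twistLinear_of_eq_zero {f : MvPowerSeries ℕ ℂ} (hf : D f = 0) :
    twistLinear D f = subst imageSeries f := by
  ext e
  rw [coeff_twistLinear D (Nat.lt_succ_self _), Finset.sum_eq_single 0]
  · rw [twistTerm_apply, divPow_zero, mul_zero, pow_zero, one_mul]
  · intro j _ hj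
    rw [twistTerm_apply, divPow_of_eq_zero D hf hj, ← substAlgHom_apply hasSubst_imageSeries,
      map_zero, mul_zero]
  · simp

/-- The twisted substitution `f ↦ ∑ⱼ x₁ ^ (3 j) Φ(Dʲ f) / j!`. -/
noncomputable def twist : MvPowerSeries ℕ ℂ →ₐ[ℂ] MvPowerSeries (Fin 2) ℂ :=
  AlgHom.ofLinearMap (twistLinear D)
    (by rw [twistLinear_of_eq_zero D D.map_one_eq_zero, ← substAlgHom_apply hasSubst_imageSeries,
      map_one])
    (twistLinear_mul D)

theorem twist_of_eq_zero {f : MvPowerSeries ℕ ℂ} (hf : D f = 0) :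
    twist D f = subst imageSeries f := twistLinear_of_eq_zero D hf

theorem coeff_twist (e : Fin 2 →₀ ℕ) (f : MvPowerSeries ℕ ℂ) :
    coeff e (twist D f) = ∑ j ∈ Finset.range (e 0 + 1), coeff e (twistTerm D j f) := rfl

variable {D}

theorem coeff_divPow_eq_zero
    (hD : ∀ (N : ℕ) (f : MvPowerSeries ℕ ℂ), (∀ r, Finsupp.weight wt r < N → coeff r f = 0) →
      ∀ r, Finsupp.weight wt r + 2 < N → coeff r (D f) = 0)
    {N : ℕ} {f : MvPowerSeries ℕ ℂ} (hf : ∀ r, Finsupp.weight wt r < N → coeff r f = 0) (j : ℕ) :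
    ∀ r, Finsupp.weight wt r + 2 * j < N → coeff r (divPow D j f) = 0 := by
  induction j with
  | zero => simpa [divPow_zero] using hf
  | succ j ih =>
    intro r hr
    have h1 := hD (N - 2 * j) _ (fun r hr => ih r (by omega)) r (by omega)
    rw [← divPow_succ, map_smul, smul_eq_mul] at h1
    exact (mul_eq_zero.mp h1).resolve_left (Nat.cast_ne_zero.mpr (Nat.succ_ne_zero j))

theorem coeff_subst_imageSeries_eq_zero {f : MvPowerSeries ℕ ℂ} {e : Fin 2 →₀ ℕ}
    (h : ∀ d, Finsupp.weight wt d = e 0 → coeff d f = 0) :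
    coeff e (subst imageSeries f) = 0 := by
  rw [coeff_subst_imageSeries_congr (g := 0) (by simpa using h),
    ← substAlgHom_apply hasSubst_imageSeries, map_zero, map_zero]

theorem coeff_twist_eq_coeff_subst
    (hD : ∀ (N : ℕ) (f : MvPowerSeries ℕ ℂ), (∀ r, Finsupp.weight wt r < N → coeff r f = 0) →
      ∀ r, Finsupp.weight wt r + 2 < N → coeff r (D f) = 0)
    {f : MvPowerSeries ℕ ℂ} {e : Fin 2 →₀ ℕ}
    (hf : ∀ r, Finsupp.weight wt r < e 0 → coeff r f = 0) :
    coeff e (twist D f) = coeff e (subst imageSeries f) := by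
  rw [coeff_twist, Finset.sum_eq_single 0]
  · rw [twistTerm_apply, divPow_zero, mul_zero, pow_zero, one_mul]
  · intro j _ hj
    rcases Nat.lt_or_ge (e 0) (3 * j) with h | h
    · exact coeff_twistTerm_of_lt D h f
    · obtain ⟨e', rfl⟩ := exists_add_of_le (Finsupp.single_le_iff.mpr h)
      rw [twistTerm_apply, X_pow_eq, coeff_add_monomial_mul, one_mul]
      -- A contributing `d` has weight `e 0 - 3 j`, hence weight plus `2 j` is below `e 0`, where
      -- `divPow D j f` vanishes.
      refine coeff_subst_imageSeries_eq_zero fun d hd => coeff_divPow_eq_zero hD hf j d ?_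
      rw [hd]
      simp
      omega
  · simp

/-- Only the untwisted term reaches the lowest nonzero weight component of `f`, so that component
lies in the kernel of the substitution. -/
theorem eq_zero_of_twist_eq_zero
    (hD : ∀ (N : ℕ) (f : MvPowerSeries ℕ ℂ), (∀ r, Finsupp.weight wt r < N → coeff r f = 0) →
      ∀ r, Finsupp.weight wt r + 2 < N → coeff r (D f) = 0)
    {f : MvPowerSeries ℕ ℂ} (hf : f ∈ testSubalgebra) (h0 : twist D f = 0) : f = 0 := by
  classical
  by_contra hne
  have hex : ∃ N, ∃ d, Finsupp.weight wt d = N ∧ coeff d f ≠ 0 := by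
    by_contra! h
    exact hne (MvPowerSeries.ext fun d => by rw [h _ d rfl, map_zero])
  obtain ⟨d, hd, hdne⟩ := Nat.find_spec hex
  have hmin : ∀ r, Finsupp.weight wt r < Nat.find hex → coeff r f = 0 := by
    intro r hr
    by_contra h
    exact Nat.find_min hex hr ⟨r, rfl, h⟩
  generalize Nat.find hex = N at hd hmin
  have h1 : subst imageSeries (weightedHomogeneousComponent wt N f) = 0 := by
    ext e
    rw [map_zero]
    by_cases he : e 0 = N
    · subst he
      rw [coeff_subst_imageSeries_congr (g := f), ← coeff_twist_eq_coeff_subst hD hmin, h0,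
        map_zero]
      intro d hd
      rw [coeff_weightedHomogeneousComponent, if_pos hd]
    · refine coeff_subst_imageSeries_eq_zero fun d hd => ?_
      rw [coeff_weightedHomogeneousComponent, if_neg (by rw [hd]; exact he)]
  have h2 := eq_zero_of_subst_imageSeries_eq_zero N _
    (weightedHomogeneousComponent_mem_testSubalgebra hf N)
    (isWeightedHomogeneous_weightedHomogeneousComponent wt f N) h1
  have h3 := congrArg (coeff d) h2
  rw [coeff_weightedHomogeneousComponent, if_pos hd, map_zero] at h3
  exact hdne h3

theorem weight_diagExponent (i : ℕ) : Finsupp.weight wt (diagExponent i) = 2 := by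
  simp [diagExponent, Finsupp.weight_single, wt]

theorem degree_diagExponent (i : ℕ) : (diagExponent i).degree = 2 := by
  simp [diagExponent]

theorem constantCoeff_subst_imageSeries (f : MvPowerSeries ℕ ℂ) :
    constantCoeff (subst imageSeries f) = constantCoeff f := by
  have h0 : ∀ i, constantCoeff (imageSeries i) = 0 := by
    intro i
    rw [← coeff_zero_eq_constantCoeff_apply, coeff_imageSeries (s := 1) (by simp),
      coeff_zero_eq_constantCoeff_apply, constantCoeff_truncSeries]
  have h1 : constantCoeff (subst imageSeries (f - constantCoeff f • 1)) = 0 :=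
    constantCoeff_subst_eq_zero hasSubst_imageSeries h0 (by simp)
  rw [← substAlgHom_apply hasSubst_imageSeries, map_sub, map_smul, map_one] at h1
  rw [← substAlgHom_apply hasSubst_imageSeries]
  simpa [sub_eq_zero] using h1

/-- Only `j = 1` contributes: the term `j = 0` has degree `2` in `x₁`, and those with `j ≥ 2` are
divisible by `x₁ ^ 6`. -/
theorem coeff_twist_diagForm :
    coeff (Finsupp.single 0 3) (twist D diagForm) = constantCoeff (D diagForm) := by
  have h1 : coeff (Finsupp.single 0 3) (twistTerm D 0 diagForm) = 0 := by
    rw [twistTerm_apply, divPow_zero, mul_zero, pow_zero, one_mul]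
    refine coeff_subst_imageSeries_eq_zero fun d hd => coeff_diagForm_of_notMem ?_
    rintro ⟨i, rfl⟩
    simp [weight_diagExponent] at hd
  rw [coeff_twist, Finset.sum_eq_single 1]
  · have h2 := divPow_succ D 0 diagForm
    rw [divPow_zero, zero_add, Nat.cast_one, one_smul] at h2
    rw [twistTerm_apply, h2, mul_one, X_pow_eq, ← constantCoeff_subst_imageSeries (D diagForm),
      ← coeff_zero_eq_constantCoeff_apply]
    have h3 := coeff_add_monomial_mul (Finsupp.single (0 : Fin 2) 3) 0
      (subst imageSeries (D diagForm)) (1 : ℂ)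
    rwa [add_zero, one_mul] at h3
  · intro j _ hj
    rcases Nat.eq_zero_or_pos j with rfl | hj'
    · exact h1
    · refine coeff_twistTerm_of_lt D ?_ _
      rw [Finsupp.single_eq_same]
      omega
  · simp

end Exponential

theorem diagForm_mem_testSubalgebra : diagForm ∈ testSubalgebra := by
  rw [mem_testSubalgebra]
  intro m
  refine (diagExponent_injective.summable_iff fun r hr => ?_).mp ?_
  · rw [coeff_diagForm_of_notMem hr, norm_zero, zero_mul]
  · simp only [Function.comp_def, coeff_diagForm, degree_diagExponent, norm_pow, norm_div, norm_one]
    refine Summable.mul_right _ (summable_geometric_of_lt_one (by positivity) ?_)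
    simp
    norm_num

end MvPowerSeries

/-! ### Discontinuity of the embedding -/

namespace TestAlgebra

open MvPowerSeries

theorem exists_val_eq_diagForm : ∃ v : TestAlgebra, val v = diagForm :=
  ⟨⟨diagForm, diagForm_mem_testSubalgebra⟩, rfl⟩

/-- The partial sums `∑_{i < k} 2⁻ⁱ X_{2i+2} X_{2i+3}`. -/
noncomputable def diagPartial (k : ℕ) : TestAlgebra :=
  ∑ i ∈ Finset.range k, (1 / 2 : ℂ) ^ i • (X (2 * i + 2) * X (2 * i + 3))

theorem val_diagPartial (k : ℕ) : val (diagPartial k) =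
    ∑ i ∈ Finset.range k, monomial (diagExponent i) ((1 / 2 : ℂ) ^ i) := by
  rw [diagPartial, map_sum]
  refine Finset.sum_congr rfl fun i _ => ?_
  rw [map_smul, map_mul, val_X, val_X, MvPowerSeries.X, MvPowerSeries.X, monomial_mul_monomial,
    ← diagExponent, ← map_smul, smul_eq_mul, mul_one, mul_one]

theorem coeff_val_diagPartial (k i : ℕ) : coeff (diagExponent i) (val (diagPartial k)) =
    if i < k then (1 / 2 : ℂ) ^ i else 0 := by
  classical
  simp [val_diagPartial, coeff_monomial, diagExponent_injective.eq_iff]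

theorem coeff_val_diagPartial_of_notMem (k : ℕ) {r : ℕ →₀ ℕ} (hr : r ∉ Set.range diagExponent) :
    coeff r (val (diagPartial k)) = 0 := by
  classical
  rw [val_diagPartial, map_sum]
  refine Finset.sum_eq_zero fun i _ => ?_
  rw [coeff_monomial, if_neg]
  exact fun h => hr ⟨i, h.symm⟩

theorem q_diagPartial_sub_le {v : TestAlgebra} (hv : val v = diagForm) (m k : ℕ) :
    q m (diagPartial k - v) ≤ (2 / 3) ^ k * ((∑' i : ℕ, (3 / 4 : ℝ) ^ i) * ((m : ℝ) + 1) ^ 2) := by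
  have hgeo : Summable fun i : ℕ => (3 / 4 : ℝ) ^ i :=
    summable_geometric_of_lt_one (by norm_num) (by norm_num)
  have hsupp : (Function.support fun r : ℕ →₀ ℕ =>
      ‖coeff r (val (diagPartial k - v))‖ * ((m : ℝ) + 1) ^ r.degree) ⊆ Set.range diagExponent := by
    intro r hr
    by_contra h
    refine hr ?_
    simp [hv, coeff_val_diagPartial_of_notMem k h, coeff_diagForm_of_notMem h]
  rw [q_apply, ← diagExponent_injective.tsum_eq hsupp, ← tsum_mul_right, ← tsum_mul_left]
  have hsum := (summable_coeff (diagPartial k - v) m).comp_injective diagExponent_injective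
  refine hsum.tsum_le_tsum (fun i => ?_) ((hgeo.mul_right _).mul_left _)
  simp only [degree_diagExponent]
  rw [← mul_assoc]
  refine mul_le_mul_of_nonneg_right ?_ (by positivity)
  rw [map_sub, map_sub, hv, coeff_diagForm, coeff_val_diagPartial]
  split_ifs with h
  · rw [sub_self, norm_zero]
    positivity
  -- Splitting `1 / 2 = 2 / 3 * (3 / 4)` leaves a summable factor in `i` and a factor tending to `0`
  -- with `k`.
  · rw [zero_sub, norm_neg, norm_pow, norm_div, norm_one, Complex.norm_ofNat,
      show (1 / 2 : ℝ) = 2 / 3 * (3 / 4) by norm_num, mul_pow]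
    refine mul_le_mul_of_nonneg_right ?_ (by positivity)
    exact pow_le_pow_of_le_one (by norm_num) (by norm_num) (not_lt.mp h)

theorem tendsto_diagPartial {v : TestAlgebra} (hv : val v = diagForm) :
    Tendsto diagPartial atTop (𝓝 v) := by
  rw [withSeminorms_q.tendsto_nhds]
  intro m ε hε
  have h1 : Tendsto (fun k : ℕ => (2 / 3 : ℝ) ^ k *
      ((∑' i : ℕ, (3 / 4 : ℝ) ^ i) * ((m : ℝ) + 1) ^ 2)) atTop (𝓝 0) := by
    simpa using (tendsto_pow_atTop_nhds_zero_of_lt_one (r := (2 / 3 : ℝ)) (by norm_num)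
      (by norm_num)).mul_const ((∑' i : ℕ, (3 / 4 : ℝ) ^ i) * ((m : ℝ) + 1) ^ 2)
  filter_upwards [h1.eventually (gt_mem_nhds hε)] with k hk
  exact (q_diagPartial_sub_le hv m k).trans_lt hk

theorem exists_discontinuous_embedding : ∃ Ψ : TestAlgebra →ₐ[ℂ] MvPowerSeries (Fin 2) ℂ,
    Function.Injective Ψ ∧ (∀ i : Fin 2, Ψ (X i) = MvPowerSeries.X i) ∧
      ¬ @Continuous TestAlgebra (MvPowerSeries (Fin 2) ℂ) inferInstance coordinateTopology Ψ := by
  obtain ⟨D₀, hmul, hX, hwt, hu⟩ := exists_wild_derivation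
  let D : Derivation ℂ (MvPowerSeries ℕ ℂ) (MvPowerSeries ℕ ℂ) := Derivation.mk' D₀ fun f g => by
    rw [hmul, smul_eq_mul, smul_eq_mul, mul_comm g]
  have hDX : ∀ i, D (MvPowerSeries.X i) = 0 := hX
  refine ⟨(twist D).comp val, ?_, fun i => ?_, fun hcont => ?_⟩
  · rw [injective_iff_map_eq_zero]
    intro f hf
    exact val_injective (eq_zero_of_twist_eq_zero (D := D) hwt f.2 hf)
  · rw [AlgHom.comp_apply, val_X, twist_of_eq_zero D (hDX _), subst_X hasSubst_imageSeries]
    fin_cases i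
    · exact imageSeries_zero
    · exact imageSeries_one
  · let _ : TopologicalSpace (MvPowerSeries (Fin 2) ℂ) := coordinateTopology
    obtain ⟨v, hv⟩ := exists_val_eq_diagForm
    have h1 : Tendsto (fun k => coeff (Finsupp.single 0 3) (twist D (val (diagPartial k)))) atTop
        (𝓝 (coeff (Finsupp.single 0 3) (twist D (val v)))) :=
      ((WithPiTopology.continuous_coeff ℂ _).comp hcont).continuousAt.tendsto.comp
        (tendsto_diagPartial hv)
    -- The derivation kills the polynomial partial sums, so their image is the plain substitution,
    -- homogeneous of degree `2` in `x₁`.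
    have h2 : ∀ k, coeff (Finsupp.single 0 3) (twist D (val (diagPartial k))) = 0 := by
      intro k
      rw [twist_of_eq_zero]
      · refine coeff_subst_imageSeries_eq_zero fun d hd => ?_
        refine coeff_val_diagPartial_of_notMem k ?_
        rintro ⟨i, rfl⟩
        simp [weight_diagExponent] at hd
      · simp [diagPartial, val_X, hDX, map_sum, map_smul, Derivation.leibniz]
    simp only [h2] at h1
    have h3 := tendsto_nhds_unique h1 tendsto_const_nhds
    rw [hv, coeff_twist_diagForm] at h3
    exact hu h3

end TestAlgebra

theorem mainTheorem10 :
    IsFrechetAlgebra TestAlgebra ∧ ¬ IsNormable TestAlgebra ∧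
    ∃ Ψ : TestAlgebra →ₐ[ℂ] MvPowerSeries (Fin 2) ℂ,
      Function.Injective Ψ ∧
      (∀ i : Fin 2, Ψ (TestAlgebra.X i) = MvPowerSeries.X i) ∧
      (∀ P : MvPolynomial (Fin 2) ℂ, ∃ u : TestAlgebra, Ψ u = (P : MvPowerSeries (Fin 2) ℂ)) ∧
      ¬ @Continuous TestAlgebra (MvPowerSeries (Fin 2) ℂ) inferInstance coordinateTopology Ψ := by
  obtain ⟨Ψ, hinj, hX, hcont⟩ := TestAlgebra.exists_discontinuous_embedding
  refine ⟨TestAlgebra.isFrechetAlgebra, TestAlgebra.not_isNormable, Ψ, hinj, hX, fun P => ?_, hcont⟩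
  refine ⟨MvPolynomial.aeval (fun i : Fin 2 => TestAlgebra.X i) P, ?_⟩
  have h : Ψ.comp (MvPolynomial.aeval fun i : Fin 2 => TestAlgebra.X i) =
      MvPolynomial.coeToMvPowerSeries.algHom ℂ := by
    refine MvPolynomial.algHom_ext fun i => ?_
    simp [hX]
  simpa using DFunLike.congr_fun h P
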